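/- A simplicial complex is a family of finite sets (faces, the empty set included) closed under taking subsets; $\langle F_1,\dots,F_j\rangle$ is the complex of all subsets of the $F_i$; $\dim\sigma=|\sigma|-1$, and the dimension of a complex is the maximum of the dimensions of its faces. For a face $\sigma$ of $K$, $\operatorname{link}_K\sigma=\{\tau\in K : \tau\cup\sigma\in K,\ \tau\cap\sigma=\varnothing\}$. Fix a field $\Bbbk$. A complex is acyclic if all its reduced simplicial homology groups over $\Bbbk$ vanish, and $K$ is $k$-fold acyclic if $\operatorname{link}_K\sigma$ is acyclic for every face $\sigma\in K$ with $|\sigma|<k$. A rank $k$ boolean interval of a poset $P$ is an interval $[x,y]\subseteq P$ isomorphic to the poset $2^{[k]}$ of subsets of $[k]=\{1,\dots,k\}$. Stanley's Conjecture 2.4 asserts: for every $k\ge 0$, the face poset of every finite $k$-fold acyclic simplicial complex is a disjoint union of rank $k$ boolean intervals, the minimal faces of which together form a subcomplex. On the vertices $A,B,\dots,L$ (writing $ABCE$ for $\{A,B,C,E\}$, and so on) let \[ \Gamma=\langle ABCE, BCEF, BCDF, ABCG, BCGH, BCDH, ABEG, BEFG, BFHG\rangle \] and let $\Delta$ be the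 complex generated by the nine sets above together with \[ \begin{array}{lllll} ABCJ,& ABIJ,& BCIJ,& BCDI,& CDIJ,\\ ABEK,& ABIK,& BEIK,& BEFI,& EFIK,\\ ABGL,& ABIL,& BGIL,& BGHI,& GHIL,\\ CDFK,& CDJK,& CFJK,& CEFJ,& EFJK,\\ CDHL,& CDJL,& CHJL,& CGHJ,& GHJL,\\ EFGL,& EFKL,& FGKL,& FGHK,& GHKL. \end{array} \] Let $\Omega_{17}$ be the complex obtained by gluing $17$ copies of $\Delta$ together along $\Gamma$, that is, the union of $17$ copies of $\Delta$ in which the vertices of $\Gamma$ are shared by all copies and the other vertices of different copies are distinct. Then, for every field $\Bbbk$: (1) $\Gamma$ is a simplicial $3$-ball (its geometric realization is homeomorphic to the closed unit ball of $\mathbb R^3$) and an induced subcomplex of $\Delta$ (that is, $\Gamma=\{\sigma\in\Delta:\sigma\subseteq W\}$ for some set $W$ of vertices); (2) $\Omega_{17}$ is $3$-dimensional and $2$-fold acyclic over $\Bbbk$; (3) the face poset of $\Omega_{17}$ is not a disjoint union of rank $2$ boolean intervals. Consequently, Stanley's Conjecture 2.4 is false over every field. -/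

import Mathlib

namespace BoolDecomp

/-- A simplicial complex with vertices in `V`: a set of finite subsets of `V` that is closed under
taking subsets. The empty set is allowed as a face. -/
abbrev Complex (V : Type*) := LowerSet (Finset V)

/-- The complex `⟨F₁, …, Fⱼ⟩` of all subsets of the sets `F₁, …, Fⱼ`. -/
def generated {V : Type*} (F : Set (Finset V)) : Complex V := lowerClosure F

/-- `dim K = d`: the maximum of `dim σ = |σ| - 1` over the faces `σ` of `K` exists and is `d`. -/
def HasDim {V : Type*} (K : Complex V) (d : ℤ) : Prop :=
  IsGreatest {i : ℤ | ∃ σ ∈ K, i = (σ.card : ℤ) - 1} d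

/-- The induced subcomplex `K|_W`. -/
def induced {V : Type*} (K : Complex V) (W : Set V) : Complex V where
  carrier := {σ | σ ∈ K ∧ (σ : Set V) ⊆ W}
  lower' := fun _ _ hτσ hσ => ⟨K.lower hτσ hσ.1, fun _ hv => hσ.2 (hτσ hv)⟩

/-- `L` is an induced subcomplex of `K`. -/
def IsInducedSubcomplex {V : Type*} (L K : Complex V) : Prop :=
  ∃ W : Set V, L = induced K W

/-- The link of `σ` in `K`. -/
def link {V : Type*} [DecidableEq V] (K : Complex V) (σ : Finset V) : Complex V where
  carrier := {τ | τ ∈ K ∧ τ ∪ σ ∈ K ∧ τ ∩ σ = ∅}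
  lower' := fun _ _ hτ h =>
    ⟨K.lower hτ h.1, K.lower (Finset.union_subset_union_left hτ) h.2.1,
      Finset.subset_empty.1 (h.2.2 ▸ Finset.inter_subset_inter_right hτ)⟩

/-! ### Reduced simplicial homology -/

/-- The quotient `Z / B` of a submodule `Z` by a submodule `B` contained in it. -/
abbrev SubQuotient {R M : Type*} [Ring R] [AddCommGroup M] [Module R M] (Z B : Submodule R M) :
    Type _ :=
  Z ⧸ B.submoduleOf Z

section Homology

variable (𝕜 : Type*) [Field 𝕜] {V : Type*} [LinearOrder V]

/-- The simplicial boundary map on formal linear combinations of finite sets of vertices: for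
`σ = {v₀ < ⋯ < vₙ}` it is `∂σ = ∑ⱼ (-1)ʲ (σ \ {vⱼ})`. In particular `∂{v} = ∅` (the augmentation)
and `∂∅ = 0`. -/
noncomputable def boundary : (Finset V →₀ 𝕜) →ₗ[𝕜] (Finset V →₀ 𝕜) :=
  Finsupp.linearCombination 𝕜 fun σ : Finset V =>
    ∑ v ∈ σ, Finsupp.single (σ.erase v) ((-1 : 𝕜) ^ (σ.filter (· < v)).card)

/-- The space `C_i(K)` of `i`-chains: linear combinations of the `i`-dimensional faces of `K`
(the empty face has dimension `-1`). -/
def chains (K : Complex V) (i : ℤ) : Submodule 𝕜 (Finset V →₀ 𝕜) :=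
  Finsupp.supported 𝕜 𝕜 {σ : Finset V | σ ∈ K ∧ (σ.card : ℤ) = i + 1}

/-- The space of `i`-cycles, `ker (∂ : C_i(K) → C_{i-1}(K))`. -/
noncomputable def cycles (K : Complex V) (i : ℤ) : Submodule 𝕜 (Finset V →₀ 𝕜) :=
  chains 𝕜 K i ⊓ LinearMap.ker (boundary 𝕜)

/-- The space of `i`-boundaries, `im (∂ : C_{i+1}(K) → C_i(K))`. -/
noncomputable def boundaries (K : Complex V) (i : ℤ) : Submodule 𝕜 (Finset V →₀ 𝕜) :=
  (chains 𝕜 K (i + 1)).map (boundary 𝕜)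

/-- The reduced simplicial homology `H̃_i(K; 𝕜)`. -/
abbrev ReducedHomology (K : Complex V) (i : ℤ) : Type _ :=
  SubQuotient (cycles 𝕜 K i) (boundaries 𝕜 K i)

/-- `K` is acyclic over `𝕜`: all its reduced homology groups vanish. -/
def Acyclic (K : Complex V) : Prop :=
  ∀ i : ℤ, Subsingleton (ReducedHomology 𝕜 K i)

/-- `K` is `k`-fold acyclic over `𝕜`. -/
def FoldAcyclic (k : ℕ) (K : Complex V) : Prop :=
  ∀ σ ∈ K, σ.card < k → Acyclic 𝕜 (link K σ)

end Homology

/-! ### Boolean interval decompositions -/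

section Boolean

variable {P : Type*} [PartialOrder P]

/-- `I` is a rank `k` boolean interval of `P`: an interval `[x, y]` isomorphic to `2^[k]`. -/
def IsBooleanInterval (k : ℕ) (I : Set P) : Prop :=
  (∃ x y : P, I = Set.Icc x y) ∧ Nonempty (I ≃o Set (Fin k))

/-- `B` is a decomposition of `P` into disjoint rank `k` boolean intervals. -/
def IsBooleanDecomposition (k : ℕ) (B : Set (Set P)) : Prop :=
  (∀ I ∈ B, IsBooleanInterval k I) ∧ B.PairwiseDisjoint id ∧ ⋃₀ B = Set.univ

/-- The set of the minimal elements of the intervals in `B`. -/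
def minimalElements (B : Set (Set P)) : Set P :=
  {x | ∃ I ∈ B, IsLeast I x}

end Boolean

/-- Stanley's conjecture over the field `𝕜`: the face poset of every finite `k`-fold acyclic
simplicial complex decomposes into disjoint rank `k` boolean intervals, the minimal faces of which
form a subcomplex. -/
def StanleyConjecture (𝕜 : Type*) [Field 𝕜] : Prop :=
  ∀ (V : Type) [Fintype V] [LinearOrder V] (k : ℕ) (K : Complex V), FoldAcyclic 𝕜 k K →
    ∃ B : Set (Set K), IsBooleanDecomposition k B ∧
      ∃ L : Complex V, (L : Set (Finset V)) = Subtype.val '' minimalElements B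

/-! ### Simplicial balls -/

/-- The geometric realization of `K`: the points of the standard simplex on `V` (in barycentric
coordinates) whose support is a face of `K`. -/
def realization {V : Type*} [Fintype V] (K : Complex V) : Set (V → ℝ) :=
  {x | x ∈ stdSimplex ℝ V ∧ ∃ σ ∈ K, ∀ v, v ∈ σ ↔ x v ≠ 0}

/-- `K` is a simplicial `d`-ball: its geometric realization is homeomorphic to the closed unit ball
of `ℝᵈ`. -/
def IsSimplicialBall {V : Type*} [Fintype V] (d : ℕ) (K : Complex V) : Prop :=
  Nonempty (realization K ≃ₜ Metric.closedBall (0 : EuclideanSpace ℝ (Fin d)) 1)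

/-! ### Gluing copies of a complex along an induced subcomplex -/

section Gluing

variable {V : Type*} [LinearOrder V]

open Classical in
/-- The vertex map of the `i`-th copy: the vertices of `L` are shared by all copies, each other
vertex `v` gets its own copy `(i, v)`. The lexicographic orders only serve to order the vertices. -/
noncomputable def copyVertex (L : Complex V) (N : ℕ) (i : Fin N) (v : V) :
    V ⊕ₗ (Fin N ×ₗ V) :=
  if {v} ∈ L then Sum.inlₗ v else Sum.inrₗ (toLex (i, v))

/-- The complex obtained by gluing `N` copies of `K` together along its induced subcomplex `L`:
the union of the `N` copies of `K`, in which the copies of `L` are identified. -/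
noncomputable def glue (K L : Complex V) (N : ℕ) : Complex (V ⊕ₗ (Fin N ×ₗ V)) where
  carrier := {τ | ∃ i : Fin N, ∃ σ ∈ K, τ = σ.image (copyVertex L N i)}
  lower' := by
    rintro _ ρ hρ ⟨i, σ, hσ, rfl⟩
    obtain ⟨σ', hσ', rfl⟩ := Finset.subset_image_iff.1 hρ
    exact ⟨i, σ', K.lower (Finset.coe_subset.1 hσ') hσ, rfl⟩

end Gluing

/-! ### The complexes `Γ`, `Δ` and `Ω_N` -/

abbrev A : Fin 12 := 0
abbrev B : Fin 12 := 1
abbrev C : Fin 12 := 2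
abbrev D : Fin 12 := 3
abbrev E : Fin 12 := 4
abbrev F : Fin 12 := 5
abbrev G : Fin 12 := 6
abbrev H : Fin 12 := 7
abbrev I : Fin 12 := 8
abbrev J : Fin 12 := 9
abbrev K : Fin 12 := 10
abbrev L : Fin 12 := 11

def facetsΓ : Finset (Finset (Fin 12)) :=
  {{A, B, C, E}, {B, C, E, F}, {B, C, D, F}, {A, B, C, G}, {B, C, G, H}, {B, C, D, H},
   {A, B, E, G}, {B, E, F, G}, {B, F, H, G}}

/-- The facets of `Δ` that are not in `Γ`. -/
def otherFacetsΔ : Finset (Finset (Fin 12)) :=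
  {{A, B, C, J}, {A, B, I, J}, {B, C, I, J}, {B, C, D, I}, {C, D, I, J},
   {A, B, E, K}, {A, B, I, K}, {B, E, I, K}, {B, E, F, I}, {E, F, I, K},
   {A, B, G, L}, {A, B, I, L}, {B, G, I, L}, {B, G, H, I}, {G, H, I, L},
   {C, D, F, K}, {C, D, J, K}, {C, F, J, K}, {C, E, F, J}, {E, F, J, K},
   {C, D, H, L}, {C, D, J, L}, {C, H, J, L}, {C, G, H, J}, {G, H, J, L},
   {E, F, G, L}, {E, F, K, L}, {F, G, K, L}, {F, G, H, K}, {G, H, K, L}}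

def Γ : Complex (Fin 12) := generated (facetsΓ : Set (Finset (Fin 12)))

def Δ : Complex (Fin 12) := generated ((facetsΓ ∪ otherFacetsΔ : Finset (Finset (Fin 12))) :
  Set (Finset (Fin 12)))

/-- `N` copies of `Δ` glued together along `Γ`. -/
noncomputable def Ω (N : ℕ) : Complex (Fin 12 ⊕ₗ (Fin N ×ₗ Fin 12)) := glue Δ Γ N

end BoolDecomp

/-! No decomposition of seventeen copies exists by a count. Suppose the glued complex is partitioned
into rank 2 boolean intervals. An interval containing a face of copy `i` outside `Γ` has its top
outside `Γ`, hence lies entirely in that copy. So the intervals attached to copy `i` cover `Δ \ Γ`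
and, in addition, use up some faces of `Γ`. They contain a multiple of 4 faces in total and `Δ \ Γ`
has 136 faces, so the number of faces of `Γ` used is a multiple of 4 (`four_dvd_card_usedFaces`). It
is not zero, because `Δ \ Γ` alone has no such partition (`not_isRelativeCover`, a finite search).
Different copies use disjoint sets of faces of `Γ` (`disjoint_usedFaces`), and `Γ` has only 64
faces, which suffices for at most 16 copies.

For 2-fold acyclicity, the links of the empty face and of the vertices in `Γ` and `Δ` are reduced to
nothing by removing open stars of faces whose links are cones (`Acyclic.of_deleteStar`). Since the
copies of `Δ` meet pairwise in `Γ`, the links in the glued complex are handled by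
`acyclic_finset_sup`. Both tools come from Mayer–Vietoris and the contracting homotopy of a cone, so
they work over every field.

Finally, `Γ` is a ball because it arises from one tetrahedron by four stellar subdivisions at
boundary triangles (`nonempty_stellarHomeomorph`). -/

namespace BoolDecomp

/-! ### Chains, cones and Mayer–Vietoris for reduced homology -/

section Chains

variable (𝕜 : Type*) [Field 𝕜] {V : Type*}

theorem mem_chains {K : Complex V} {i : ℤ} {z : Finset V →₀ 𝕜} :
    z ∈ chains 𝕜 K i ↔ ∀ σ, z σ ≠ 0 → σ ∈ K ∧ (σ.card : ℤ) = i + 1 := by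
  simp [chains, Finsupp.mem_supported, Set.subset_def]

theorem single_mem_chains {K : Complex V} {i : ℤ} {σ : Finset V} (hσ : σ ∈ K)
    (hi : (σ.card : ℤ) = i + 1) (c : 𝕜) : Finsupp.single σ c ∈ chains 𝕜 K i :=
  Finsupp.single_mem_supported 𝕜 c ⟨hσ, hi⟩

theorem map_mem_chains {K K' : Complex V} {i j : ℤ} (f : (Finset V →₀ 𝕜) →ₗ[𝕜] (Finset V →₀ 𝕜))
    (hf : ∀ σ ∈ K, (σ.card : ℤ) = i + 1 → f (Finsupp.single σ 1) ∈ chains 𝕜 K' j)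
    {z : Finset V →₀ 𝕜} (hz : z ∈ chains 𝕜 K i) : f z ∈ chains 𝕜 K' j := by
  have : chains 𝕜 K i ≤ (chains 𝕜 K' j).comap f := by
    unfold chains
    rw [Finsupp.supported_eq_span_single, Submodule.span_le]
    rintro _ ⟨σ, hσ, rfl⟩
    exact hf σ hσ.1 hσ.2
  exact this hz

theorem chains_mono {K K' : Complex V} (h : K ≤ K') (i : ℤ) : chains 𝕜 K i ≤ chains 𝕜 K' i :=
  Finsupp.supported_mono fun _ hσ => ⟨h hσ.1, hσ.2⟩

end Chains

section Homology

variable (𝕜 : Type*) [Field 𝕜] {V : Type*} [LinearOrder V]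

/-- The sign with which `σ \ {v}` occurs in the boundary of `σ`. -/
def vertexSign (σ : Finset V) (v : V) : 𝕜 := (-1 : 𝕜) ^ (σ.filter (· < v)).card

theorem vertexSign_mul_self (σ : Finset V) (v : V) :
    vertexSign 𝕜 σ v * vertexSign 𝕜 σ v = 1 := by
  unfold vertexSign
  rw [← mul_pow]
  simp

theorem boundary_single (σ : Finset V) :
    boundary 𝕜 (Finsupp.single σ 1) =
      ∑ v ∈ σ, Finsupp.single (σ.erase v) (vertexSign 𝕜 σ v) := by
  simp [boundary, vertexSign]

/-- The cone operator with apex `v`: `σ ↦ ± (σ ∪ {v})` for `v ∉ σ`, and `σ ↦ 0` for `v ∈ σ`. -/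
noncomputable def coneMap (v : V) : (Finset V →₀ 𝕜) →ₗ[𝕜] (Finset V →₀ 𝕜) :=
  Finsupp.linearCombination 𝕜 fun σ : Finset V =>
    if v ∈ σ then 0 else Finsupp.single (insert v σ) (vertexSign 𝕜 σ v)

theorem coneMap_single_of_mem {v : V} {σ : Finset V} (h : v ∈ σ) (c : 𝕜) :
    coneMap 𝕜 v (Finsupp.single σ c) = 0 := by
  simp [coneMap, h]

theorem coneMap_single_of_notMem {v : V} {σ : Finset V} (h : v ∉ σ) (c : 𝕜) :
    coneMap 𝕜 v (Finsupp.single σ c) = Finsupp.single (insert v σ) (c * vertexSign 𝕜 σ v) := by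
  simp [coneMap, h]

theorem vertexSign_erase_self (σ : Finset V) (v : V) :
    vertexSign 𝕜 (σ.erase v) v = vertexSign 𝕜 σ v := by
  unfold vertexSign
  congr 2
  ext u
  simp only [Finset.mem_filter, Finset.mem_erase]
  constructor
  · rintro ⟨⟨_, h⟩, h'⟩
    exact ⟨h, h'⟩
  · rintro ⟨h, h'⟩
    exact ⟨⟨h'.ne, h⟩, h'⟩

theorem vertexSign_insert_self (σ : Finset V) (v : V) :
    vertexSign 𝕜 (insert v σ) v = vertexSign 𝕜 σ v := by
  unfold vertexSign
  rw [Finset.filter_insert, if_neg (lt_irrefl v)]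

/-- Exactly one of `u < v` and `v < u` holds, so exactly one of the two counts changes, by one, when
the other vertex is added or removed. This is the cancellation behind the cone homotopy. -/
theorem vertexSign_insert_mul {σ : Finset V} {u v : V} (hv : v ∉ σ) (hu : u ∈ σ) :
    vertexSign 𝕜 σ v * vertexSign 𝕜 (insert v σ) u =
      -(vertexSign 𝕜 σ u * vertexSign 𝕜 (σ.erase u) v) := by
  have hne : u ≠ v := fun h => hv (h ▸ hu)
  obtain ⟨ρ, hρ, rfl⟩ : ∃ ρ, u ∉ ρ ∧ σ = insert u ρ :=
    ⟨σ.erase u, Finset.notMem_erase u σ, (Finset.insert_erase hu).symm⟩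
  have hvρ : v ∉ ρ := fun h => hv (Finset.mem_insert_of_mem h)
  rw [Finset.erase_insert hρ]
  unfold vertexSign
  simp only [Finset.filter_insert, lt_irrefl, if_false]
  rcases lt_or_gt_of_ne hne with h | h
  · rw [if_pos h, if_neg h.not_gt, Finset.card_insert_of_notMem (by simp [hρ])]
    ring
  · rw [if_neg h.not_gt, if_pos h, Finset.card_insert_of_notMem (by simp [hvρ])]
    ring

/-- The cone operator is a contracting homotopy. If `v ∈ σ`, only the face opposite `v` survives
coning. If `v ∉ σ`, deleting `v` from the cone gives back `σ`, and the other terms cancel in pairs.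
-/
theorem boundary_coneMap_single (v : V) (σ : Finset V) :
    boundary 𝕜 (coneMap 𝕜 v (Finsupp.single σ 1)) + coneMap 𝕜 v (boundary 𝕜 (Finsupp.single σ 1))
      = Finsupp.single σ 1 := by
  by_cases hv : v ∈ σ
  · rw [coneMap_single_of_mem 𝕜 hv, map_zero, zero_add, boundary_single, map_sum,
      Finset.sum_eq_single_of_mem v hv]
    · rw [coneMap_single_of_notMem 𝕜 (Finset.notMem_erase v σ), Finset.insert_erase hv,
        vertexSign_erase_self, vertexSign_mul_self]
    · intro u _ huv
      exact coneMap_single_of_mem 𝕜 (Finset.mem_erase.2 ⟨huv.symm, hv⟩) _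
  · have hs : ∀ c : 𝕜, Finsupp.single (insert v σ) c = c • Finsupp.single (insert v σ) 1 := by
      intro c; simp
    rw [coneMap_single_of_notMem 𝕜 hv, one_mul, hs, map_smul, boundary_single, boundary_single,
      map_sum, Finset.sum_insert hv, Finset.erase_insert hv, vertexSign_insert_self, smul_add,
      Finsupp.smul_single, smul_eq_mul, vertexSign_mul_self, add_assoc, Finset.smul_sum,
      ← Finset.sum_add_distrib, Finset.sum_eq_zero, add_zero]
    intro u hu
    have hne : v ≠ u := fun h => hv (h ▸ hu)
    rw [coneMap_single_of_notMem 𝕜 (fun h => hv (Finset.mem_of_mem_erase h)),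
      Finsupp.smul_single, smul_eq_mul, vertexSign_insert_mul 𝕜 hv hu,
      Finset.erase_insert_of_ne hne, ← Finsupp.single_add, neg_add_cancel, Finsupp.single_zero]

theorem boundary_coneMap (v : V) (z : Finset V →₀ 𝕜) :
    boundary 𝕜 (coneMap 𝕜 v z) + coneMap 𝕜 v (boundary 𝕜 z) = z := by
  have : boundary 𝕜 ∘ₗ coneMap 𝕜 v + coneMap 𝕜 v ∘ₗ boundary 𝕜 = LinearMap.id := by
    apply Finsupp.lhom_ext'
    intro σ
    apply LinearMap.ext_ring
    simpa using boundary_coneMap_single 𝕜 v σ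
  exact LinearMap.congr_fun this z

/-- The homotopy identity replaces the usual double sum. With `c` the cone operator at `v`, it gives
`∂cτ = τ - c∂τ`, and so `∂∂cτ = ∂τ - ∂c∂τ = c∂∂τ`, which vanishes by induction. -/
theorem boundary_boundary_single (σ : Finset V) :
    boundary 𝕜 (boundary 𝕜 (Finsupp.single σ 1)) = 0 := by
  induction σ using Finset.induction_on with
  | empty => simp [boundary_single]
  | insert v τ hv ih =>
    have h1 := boundary_coneMap 𝕜 v (Finsupp.single τ (vertexSign 𝕜 τ v))
    have h2 := boundary_coneMap 𝕜 v (boundary 𝕜 (Finsupp.single τ (vertexSign 𝕜 τ v)))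
    have hs : Finsupp.single τ (vertexSign 𝕜 τ v) = vertexSign 𝕜 τ v • Finsupp.single τ 1 := by
      simp
    have h3 : boundary 𝕜 (boundary 𝕜 (Finsupp.single τ (vertexSign 𝕜 τ v))) = 0 := by
      rw [hs, map_smul, map_smul, ih, smul_zero]
    rw [coneMap_single_of_notMem 𝕜 hv, vertexSign_mul_self] at h1
    rw [h3, map_zero, add_zero] at h2
    have h4 := congrArg (boundary 𝕜) h1
    rw [map_add, h2] at h4
    simpa using h4

theorem boundary_boundary (z : Finset V →₀ 𝕜) : boundary 𝕜 (boundary 𝕜 z) = 0 := by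
  have : boundary 𝕜 ∘ₗ boundary 𝕜 = (0 : (Finset V →₀ 𝕜) →ₗ[𝕜] _) := by
    apply Finsupp.lhom_ext'
    intro σ
    apply LinearMap.ext_ring
    simpa using boundary_boundary_single 𝕜 σ
  exact LinearMap.congr_fun this z

theorem acyclic_iff (K : Complex V) :
    Acyclic 𝕜 K ↔ ∀ i : ℤ, ∀ z ∈ chains 𝕜 K i, boundary 𝕜 z = 0 →
      ∃ w ∈ chains 𝕜 K (i + 1), boundary 𝕜 w = z := by
  unfold Acyclic ReducedHomology SubQuotient
  refine forall_congr' fun i => ?_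
  refine Submodule.Quotient.subsingleton_iff.trans ?_
  rw [Submodule.submoduleOf_eq_top]
  simp only [SetLike.le_def, cycles, boundaries, Submodule.mem_inf, Submodule.mem_map,
    LinearMap.mem_ker, and_imp]

theorem boundary_mem_chains {K : Complex V} {i : ℤ} {z : Finset V →₀ 𝕜}
    (hz : z ∈ chains 𝕜 K (i + 1)) : boundary 𝕜 z ∈ chains 𝕜 K i := by
  refine map_mem_chains 𝕜 _ (fun σ hσ hi => ?_) hz
  rw [boundary_single]
  refine Submodule.sum_mem _ fun v hv => single_mem_chains 𝕜 (K.lower (σ.erase_subset v) hσ) ?_ _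
  have := Finset.card_erase_add_one hv
  omega

/-- A cone is acyclic. -/
theorem acyclic_of_cone {K : Complex V} (v : V) (h : ∀ σ ∈ K, insert v σ ∈ K) : Acyclic 𝕜 K := by
  rw [acyclic_iff]
  intro i z hz hdz
  refine ⟨coneMap 𝕜 v z, map_mem_chains 𝕜 _ (fun σ hσ hi => ?_) hz, ?_⟩
  · by_cases hv : v ∈ σ
    · rw [coneMap_single_of_mem 𝕜 hv]
      exact Submodule.zero_mem _
    · rw [coneMap_single_of_notMem 𝕜 hv]
      refine single_mem_chains 𝕜 (h σ hσ) ?_ _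
      rw [Finset.card_insert_of_notMem hv]
      push_cast
      omega
  · have := boundary_coneMap 𝕜 v z
    rwa [hdz, map_zero, add_zero] at this

/-- Here `⊥` lacks even the empty face, so every chain space is zero. The complex `{∅}` would not be
acyclic. -/
theorem acyclic_bot : Acyclic 𝕜 (⊥ : Complex V) := by
  rw [acyclic_iff]
  intro i z hz _
  refine ⟨0, Submodule.zero_mem _, ?_⟩
  have : z = 0 := by
    ext σ
    by_contra hσ
    exact ((mem_chains 𝕜).1 hz σ hσ).1
  rw [this, map_zero]

/-- The union of two acyclic complexes with acyclic intersection is acyclic. -/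
theorem Acyclic.sup {M N : Complex V} (hMN : Acyclic 𝕜 (M ⊓ N)) (hM : Acyclic 𝕜 M)
    (hN : Acyclic 𝕜 N) : Acyclic 𝕜 (M ⊔ N) := by
  classical
  rw [acyclic_iff] at *
  intro i z hz hdz
  set a := z.filter (· ∈ M) with ha
  set b := z.filter (fun σ => ¬ σ ∈ M) with hb
  have hab : a + b = z := Finsupp.filter_add_filter_not z _
  have haM : a ∈ chains 𝕜 M i := by
    rw [mem_chains] at hz ⊢
    intro σ hσ
    rw [ha, Finsupp.filter_apply] at hσ
    split_ifs at hσ with h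
    · exact ⟨h, (hz σ hσ).2⟩
    · exact absurd rfl hσ
  have hbN : b ∈ chains 𝕜 N i := by
    rw [mem_chains] at hz ⊢
    intro σ hσ
    rw [hb, Finsupp.filter_apply] at hσ
    split_ifs at hσ with h
    · exact absurd rfl hσ
    · exact ⟨(LowerSet.mem_sup_iff.1 (hz σ hσ).1).resolve_left h, (hz σ hσ).2⟩
  have hd : boundary 𝕜 a = -boundary 𝕜 b := by
    rw [eq_neg_iff_add_eq_zero, ← map_add, hab, hdz]
  have hi : i = i - 1 + 1 := by ring
  have hda : boundary 𝕜 a ∈ chains 𝕜 (M ⊓ N) (i - 1) := by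
    have h1 : boundary 𝕜 a ∈ chains 𝕜 M (i - 1) := boundary_mem_chains 𝕜 (hi ▸ haM)
    have h2 : boundary 𝕜 a ∈ chains 𝕜 N (i - 1) := by
      rw [hd]
      exact Submodule.neg_mem _ (boundary_mem_chains 𝕜 (hi ▸ hbN))
    rw [mem_chains] at *
    exact fun σ hσ => ⟨⟨(h1 σ hσ).1, (h2 σ hσ).1⟩, (h1 σ hσ).2⟩
  -- The common boundary of `a` and `-b` bounds a chain `w` in the intersection; `a - w` and `b + w`
  -- are then cycles in `M` and `N` with sum `z`.
  obtain ⟨w, hw, hdw⟩ := hMN (i - 1) _ hda (boundary_boundary 𝕜 a)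
  rw [← hi] at hw
  obtain ⟨p, hp, hdp⟩ := hM i (a - w)
    (Submodule.sub_mem _ haM (chains_mono 𝕜 inf_le_left i hw)) (by rw [map_sub, hdw, sub_self])
  obtain ⟨q, hq, hdq⟩ := hN i (b + w)
    (Submodule.add_mem _ hbN (chains_mono 𝕜 inf_le_right i hw))
    (by rw [map_add, hdw, hd, add_neg_cancel])
  refine ⟨p + q, Submodule.add_mem _ (chains_mono 𝕜 le_sup_left _ hp)
    (chains_mono 𝕜 le_sup_right _ hq), ?_⟩
  rw [map_add, hdp, hdq, ← hab]
  abel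

/-- A union of acyclic complexes that pairwise meet in the same acyclic complex is acyclic. -/
theorem acyclic_finset_sup {ι : Type*} [DecidableEq ι] {M : ι → Complex V} {N : Complex V}
    (hN : Acyclic 𝕜 N) (hM : ∀ i, Acyclic 𝕜 (M i)) (hMN : ∀ i j, i ≠ j → M i ⊓ M j = N)
    {s : Finset ι} (hs : s.Nonempty) : Acyclic 𝕜 (s.sup M) := by
  induction hs using Finset.Nonempty.cons_induction with
  | singleton i => simpa using hM i
  | cons i s hi hs ih =>
    rw [Finset.sup_cons]
    refine Acyclic.sup 𝕜 ?_ (hM i) ih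
    have : M i ⊓ s.sup M = N := by
      rw [Finset.sup_inf_distrib_left]
      obtain ⟨j, hj⟩ := hs
      apply le_antisymm
      · refine Finset.sup_le fun k hk => (hMN i k ?_).le
        rintro rfl
        exact hi hk
      · rw [← hMN i j (by rintro rfl; exact hi hj)]
        exact Finset.le_sup (f := fun k => M i ⊓ M k) hj
    rw [this]
    exact hN

/-- The faces of `K` that do not contain `R`. -/
def deleteStar (K : Complex V) (R : Finset V) : Complex V where
  carrier := {σ | σ ∈ K ∧ ¬ R ⊆ σ}
  lower' := fun _ _ hτσ hσ => ⟨K.lower hτσ hσ.1, fun h => hσ.2 (h.trans hτσ)⟩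

/-- Removing the open star of a face whose link is a cone does not affect acyclicity. -/
theorem Acyclic.of_deleteStar {K : Complex V} {R : Finset V} {v : V} (hv : v ∉ R)
    (h : ∀ σ ∈ K, R ⊆ σ → insert v σ ∈ K) (hK : Acyclic 𝕜 (deleteStar K R)) :
    Acyclic 𝕜 K := by
  -- `S` is the closed star of `R`. Both `S` and its intersection with `deleteStar K R` are cones
  -- with apex `v`; for the latter, `v ∉ R` ensures that adding `v` does not complete `R`.
  let S : Complex V :=
    { carrier := {σ | σ ∪ R ∈ K}
      lower' := fun _ _ hτσ hσ => K.lower (Finset.union_subset_union_left hτσ) hσ }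
  have hS : ∀ σ ∈ S, insert v σ ∈ S := by
    intro σ hσ
    change insert v σ ∪ R ∈ K
    rw [Finset.insert_union]
    exact h _ hσ Finset.subset_union_right
  have hsup : S ⊔ deleteStar K R = K := by
    ext σ
    simp only [SetLike.mem_coe, LowerSet.mem_sup_iff]
    constructor
    · rintro (hσ | hσ)
      · exact K.lower (Finset.subset_union_left (s₂ := R)) hσ
      · exact hσ.1
    · intro hσ
      by_cases hR : R ⊆ σ
      · left
        change σ ∪ R ∈ K
        rwa [Finset.union_eq_left.2 hR]
      · exact Or.inr ⟨hσ, hR⟩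
  rw [← hsup]
  refine Acyclic.sup 𝕜 (acyclic_of_cone 𝕜 v ?_) (acyclic_of_cone 𝕜 v hS) hK
  rintro σ ⟨hσS, hσ⟩
  have h1 : insert v σ ∈ S := hS σ hσS
  refine ⟨h1, K.lower (Finset.subset_union_left (s₂ := R)) h1, fun hR => hσ.2 ?_⟩
  exact (Finset.subset_insert_iff_of_notMem hv).1 hR

/-- The image of a complex under a map of the vertices. -/
def mapComplex {V W : Type*} (f : V ↪ W) (K : Complex V) : Complex W where
  carrier := {τ | ∃ σ ∈ K, σ.map f = τ}
  lower' := by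
    rintro _ ρ hρ ⟨σ, hσ, rfl⟩
    obtain ⟨σ', hσ', rfl⟩ := Finset.subset_map_iff.1 hρ
    exact ⟨σ', K.lower hσ' hσ, rfl⟩

variable {W : Type*} [LinearOrder W]

/-- Monotonicity matters because the signs depend on the order of the vertices. -/
theorem boundary_mapDomain (f : V ↪ W) (hf : StrictMono f) (z : Finset V →₀ 𝕜) :
    boundary 𝕜 (z.mapDomain (Finset.map f)) = (boundary 𝕜 z).mapDomain (Finset.map f) := by
  have : boundary 𝕜 ∘ₗ Finsupp.lmapDomain 𝕜 𝕜 (Finset.map f) =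
      Finsupp.lmapDomain 𝕜 𝕜 (Finset.map f) ∘ₗ boundary 𝕜 := by
    apply Finsupp.lhom_ext'
    intro σ
    apply LinearMap.ext_ring
    simp only [LinearMap.comp_apply, Finsupp.lsingle_apply, Finsupp.lmapDomain_apply,
      Finsupp.mapDomain_single]
    rw [boundary_single, boundary_single, ← Finsupp.lmapDomain_apply 𝕜 𝕜, map_sum, Finset.sum_map]
    refine Finset.sum_congr rfl fun v _ => ?_
    rw [Finsupp.lmapDomain_apply, Finsupp.mapDomain_single, Finset.map_erase]
    congr 1
    unfold vertexSign
    rw [Finset.filter_map, Finset.card_map]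
    congr 3
    ext u
    simp [hf.lt_iff_lt]
  exact LinearMap.congr_fun this z

theorem Acyclic.map {K : Complex V} (hK : Acyclic 𝕜 K) (f : V ↪ W) (hf : StrictMono f) :
    Acyclic 𝕜 (mapComplex f K) := by
  rw [acyclic_iff] at *
  intro i z hz hdz
  have hinj : Function.Injective (Finset.map f) := Finset.map_injective f
  obtain ⟨y, rfl⟩ : ∃ y, Finsupp.mapDomain (Finset.map f) y = z := by
    refine ⟨z.comapDomain (Finset.map f) hinj.injOn, Finsupp.mapDomain_comapDomain _ hinj _ ?_⟩
    intro σ hσ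
    obtain ⟨⟨τ, _, rfl⟩, _⟩ := (mem_chains 𝕜).1 hz σ (Finsupp.mem_support_iff.1 hσ)
    exact ⟨τ, rfl⟩
  have hy : y ∈ chains 𝕜 K i := by
    rw [mem_chains] at hz ⊢
    intro σ hσ
    obtain ⟨⟨τ, hτ, hτσ⟩, hc⟩ := hz (σ.map f) (by rwa [Finsupp.mapDomain_apply hinj])
    rw [Finset.card_map] at hc
    exact ⟨hinj hτσ ▸ hτ, hc⟩
  rw [boundary_mapDomain 𝕜 f hf] at hdz
  obtain ⟨w, hw, hdw⟩ := hK i y hy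
    (Finsupp.mapDomain_injective hinj (by rw [hdz, Finsupp.mapDomain_zero]))
  refine ⟨w.mapDomain (Finset.map f), ?_, by rw [boundary_mapDomain 𝕜 f hf, hdw]⟩
  rw [mem_chains] at hw ⊢
  intro σ hσ
  classical
  obtain ⟨τ, hτ, rfl⟩ := Finset.mem_image.1
    (Finsupp.mapDomain_support (Finsupp.mem_support_iff.2 hσ))
  obtain ⟨h1, h2⟩ := hw τ (Finsupp.mem_support_iff.1 hτ)
  exact ⟨⟨τ, h1, rfl⟩, by rw [Finset.card_map]; exact h2⟩

end Homology

end BoolDecomp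

namespace BoolDecomp

/-! ### Sets of vertices as binary numbers -/

/-- The number whose binary digits are the indicator function of `σ`. -/
def mask (σ : Finset (Fin 12)) : ℕ := Nat.ofBits fun i => decide (i ∈ σ)

theorem testBit_mask (σ : Finset (Fin 12)) (i : ℕ) :
    (mask σ).testBit i = decide (∃ h : i < 12, (⟨i, h⟩ : Fin 12) ∈ σ) := by
  unfold mask
  by_cases h : i < 12
  · simp [h]
  · simp [h, Nat.testBit_ofBits_ge _ _ (not_lt.1 h)]

theorem testBit_mask_fin (σ : Finset (Fin 12)) (i : Fin 12) :
    (mask σ).testBit i = decide (i ∈ σ) := by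
  simp [testBit_mask]

theorem mask_injective : Function.Injective mask := by
  intro σ τ h
  ext i
  have := congrArg (fun n => n.testBit (i : ℕ)) h
  simpa [testBit_mask_fin] using this

theorem mask_union (σ τ : Finset (Fin 12)) : mask (σ ∪ τ) = mask σ ||| mask τ := by
  apply Nat.eq_of_testBit_eq
  intro i
  by_cases h : i < 12 <;> simp [testBit_mask, h]

theorem mask_inter (σ τ : Finset (Fin 12)) : mask (σ ∩ τ) = mask σ &&& mask τ := by
  apply Nat.eq_of_testBit_eq
  intro i
  by_cases h : i < 12 <;> simp [testBit_mask, h]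

theorem mask_empty : mask ∅ = 0 := by decide

theorem mask_insert (v : Fin 12) (σ : Finset (Fin 12)) :
    mask (insert v σ) = mask {v} ||| mask σ := by
  rw [← mask_union, Finset.insert_eq]

/-- Inclusion of sets of vertices given by their masks. -/
def maskLE (m n : ℕ) : Bool := (m.land n).beq m

theorem maskLE_mask {σ τ : Finset (Fin 12)} : maskLE (mask σ) (mask τ) = true ↔ σ ⊆ τ := by
  rw [maskLE, Nat.beq_eq]
  change mask σ &&& mask τ = mask σ ↔ _
  rw [← mask_inter, mask_injective.eq_iff, Finset.inter_eq_left]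

/-- Membership in a list of masks. -/
def maskMem (m : ℕ) (l : List ℕ) : Bool := l.any m.beq

theorem maskMem_iff {m : ℕ} {l : List ℕ} : maskMem m l = true ↔ m ∈ l := by
  simp [maskMem]

theorem exists_mask_eq {m : ℕ} (hm : m < 4096) : ∃ σ, mask σ = m := by
  refine ⟨Finset.univ.filter fun i : Fin 12 => m.testBit i, ?_⟩
  apply Nat.eq_of_testBit_eq
  intro i
  by_cases h : i < 12
  · simp [testBit_mask, h]
  · have : m < 2 ^ i := hm.trans_le
      (le_trans (by norm_num) (Nat.pow_le_pow_right two_pos (not_lt.1 h)))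
    simp [testBit_mask, h, Nat.testBit_lt_two_pow this]

/-- The list of the masks of the faces of `K` is `l`. -/
def HasFaceMasks (K : Complex (Fin 12)) (l : List ℕ) : Prop := ∀ σ, σ ∈ K ↔ mask σ ∈ l

/-- The masks of the subsets of a set of vertices, given as a list. -/
def subMasks : List (Fin 12) → List ℕ
  | [] => [0]
  | v :: s => subMasks s ++ (subMasks s).map fun m => (Nat.shiftLeft 1 v).lor m

theorem mask_singleton (v : Fin 12) : mask {v} = Nat.shiftLeft 1 v := by
  revert v
  decide

theorem mask_mem_subMasks {s : List (Fin 12)} {σ : Finset (Fin 12)} (h : σ ⊆ s.toFinset) :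
    mask σ ∈ subMasks s := by
  induction s generalizing σ with
  | nil =>
    obtain rfl : σ = ∅ := by simpa using h
    simp [subMasks, mask_empty]
  | cons v s ih =>
    rw [List.toFinset_cons] at h
    rw [subMasks, List.mem_append, List.mem_map]
    by_cases hv : v ∈ σ
    · refine Or.inr ⟨mask (σ.erase v), ih (Finset.subset_insert_iff.1 h), ?_⟩
      rw [← mask_singleton]
      change mask {v} ||| mask (σ.erase v) = _
      rw [← mask_insert, Finset.insert_erase hv]
    · exact Or.inl (ih ((Finset.subset_insert_iff_of_notMem hv).1 h))

/-- A list of masks as a single binary number. -/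
def maskSet (l : List ℕ) : ℕ := l.foldr (fun m n => (Nat.shiftLeft 1 m).lor n) 0

theorem testBit_maskSet (l : List ℕ) (m : ℕ) : (maskSet l).testBit m = true ↔ m ∈ l := by
  induction l with
  | nil => simp [maskSet]
  | cons a l ih =>
    change ((1 <<< a) ||| maskSet l).testBit m = true ↔ _
    rw [Nat.testBit_or, Bool.or_eq_true, ih, List.mem_cons, Nat.one_shiftLeft,
      Nat.testBit_two_pow, decide_eq_true_eq, eq_comm]

/-! ### Certificates for acyclicity -/

/-- Check that the complex with the given face masks can be reduced to nothing by successively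
removing open stars of sets `R` (given by their masks) whose link is a cone with apex `v`. -/
def reduces : List ℕ → List (ℕ × Fin 12) → Bool
  | l, [] => l.isEmpty
  | l, (R, v) :: s =>
    R.blt 4096 && !R.testBit v &&
      ((l.filter (maskLE R)).all fun m =>
        maskMem ((Nat.shiftLeft 1 v).lor m) (l.filter (maskLE R))) &&
      reduces (l.filter fun m => !maskLE R m) s

/-- Each entry of the certificate is one application of `Acyclic.of_deleteStar`. An entry with `R =
0` removes the open star of the empty face, which is everything, so it finishes a complex that has
become a cone. -/
theorem acyclic_of_reduces (𝕜 : Type*) [Field 𝕜] {K : Complex (Fin 12)} {l : List ℕ}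
    {s : List (ℕ × Fin 12)} (hl : HasFaceMasks K l) (h : reduces l s = true) :
    Acyclic 𝕜 K := by
  induction s generalizing K l with
  | nil =>
    obtain rfl : l = [] := by simpa [reduces] using h
    obtain rfl : K = ⊥ := by
      rw [eq_bot_iff]
      intro σ hσ
      simpa using (hl σ).1 hσ
    exact acyclic_bot 𝕜
  | cons p s ih =>
    obtain ⟨R, v⟩ := p
    simp only [reduces, Bool.and_eq_true, List.all_eq_true, Bool.not_eq_true', maskMem_iff,
      Nat.blt_eq, List.mem_filter, and_imp] at h
    obtain ⟨⟨⟨hR, hv⟩, hcone⟩, hs⟩ := h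
    obtain ⟨R, rfl⟩ := exists_mask_eq hR
    rw [testBit_mask_fin, decide_eq_false_iff_not] at hv
    refine Acyclic.of_deleteStar 𝕜 (R := R) hv (fun σ hσ hR => ?_) (ih (fun σ => ?_) hs)
    · rw [hl, mask_insert, mask_singleton]
      exact (hcone _ ((hl σ).1 hσ) (maskLE_mask.2 hR)).1
    · rw [List.mem_filter, Bool.not_eq_true', ← hl, Bool.eq_false_iff, Ne, maskLE_mask]
      rfl

/-- The masks of the faces of the link of the face with mask `s`. -/
def linkMasks (l : List ℕ) (s : ℕ) : List ℕ := (l.filter (maskLE s)).map (Nat.xor s)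

theorem mask_sdiff {σ τ : Finset (Fin 12)} (h : σ ⊆ τ) : mask (τ \ σ) = (mask σ).xor (mask τ) := by
  apply Nat.eq_of_testBit_eq
  intro i
  change _ = (mask σ ^^^ mask τ).testBit i
  rw [Nat.testBit_xor]
  by_cases hi : i < 12
  · simp only [testBit_mask, hi, exists_true_left, Finset.mem_sdiff]
    by_cases h1 : (⟨i, hi⟩ : Fin 12) ∈ σ
    · simp [h1, h h1]
    · simp [h1]
  · simp [testBit_mask, hi]

theorem HasFaceMasks.link {K : Complex (Fin 12)} {l : List ℕ} (hl : HasFaceMasks K l)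
    (hlt : ∀ m ∈ l, m < 4096) (s : Finset (Fin 12)) :
    HasFaceMasks (link K s) (linkMasks l (mask s)) := by
  intro σ
  simp only [linkMasks, List.mem_map, List.mem_filter]
  constructor
  · rintro ⟨-, hσ, hdisj⟩
    refine ⟨mask (σ ∪ s), ⟨(hl _).1 hσ, maskLE_mask.2 Finset.subset_union_right⟩, ?_⟩
    rw [← mask_sdiff Finset.subset_union_right, Finset.union_sdiff_right,
      Finset.sdiff_eq_self_of_disjoint (Finset.disjoint_iff_inter_eq_empty.2 hdisj)]
  · rintro ⟨m, ⟨hm, hsm⟩, hσ⟩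
    obtain ⟨τ, rfl⟩ := exists_mask_eq (hlt m hm)
    rw [maskLE_mask] at hsm
    rw [← mask_sdiff hsm, mask_injective.eq_iff] at hσ
    have hτ := (hl τ).2 hm
    subst hσ
    refine ⟨K.lower Finset.sdiff_subset hτ, ?_, ?_⟩
    · rwa [Finset.sdiff_union_of_subset hsm]
    · simp

/-- The relevant faces are the empty one and the vertices; `c` pairs the mask of each with a
reduction of its link. -/
theorem foldAcyclic_two_of_reduces (𝕜 : Type*) [Field 𝕜] {K : Complex (Fin 12)} {l : List ℕ}
    (hl : HasFaceMasks K l) (hlt : ∀ m ∈ l, m < 4096) (c : List (ℕ × List (ℕ × Fin 12)))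
    (hc : (c.all fun p => reduces (linkMasks l p.1) p.2) = true)
    (h0 : maskMem 0 (c.map Prod.fst) = true)
    (h1 : ∀ v : Fin 12, maskMem (Nat.shiftLeft 1 v) l = true →
      maskMem (Nat.shiftLeft 1 v) (c.map Prod.fst) = true) :
    FoldAcyclic 𝕜 2 K := by
  intro σ hσ hcard
  have hmem : mask σ ∈ c.map Prod.fst := by
    rw [← maskMem_iff]
    rcases Nat.lt_succ_iff_lt_or_eq.1 hcard with h | h
    · rw [Finset.card_eq_zero.1 (Nat.lt_one_iff.1 h), mask_empty]
      exact h0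
    · obtain ⟨v, rfl⟩ := Finset.card_eq_one.1 h
      rw [hl, mask_singleton, ← maskMem_iff] at hσ
      rw [mask_singleton]
      exact h1 v hσ
  obtain ⟨p, hp, hpσ⟩ := List.mem_map.1 hmem
  have h := List.all_eq_true.1 hc p hp
  rw [hpσ] at h
  exact acyclic_of_reduces 𝕜 (hl.link hlt σ) h

/-! ### The faces of `Γ` and `Δ` -/

/-- The facets of `Γ`. -/
def facetListΓ : List (List (Fin 12)) :=
  [[A, B, C, E], [B, C, E, F], [B, C, D, F], [A, B, C, G], [B, C, G, H], [B, C, D, H], [A, B, E,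
   G], [B, E, F, G], [B, F, H, G]]

/-- The facets of `Δ` that are not in `Γ`. -/
def otherFacetListΔ : List (List (Fin 12)) :=
  [[A, B, C, J], [A, B, I, J], [B, C, I, J], [B, C, D, I], [C, D, I, J], [A, B, E, K], [A, B, I,
   K], [B, E, I, K], [B, E, F, I], [E, F, I, K], [A, B, G, L], [A, B, I, L], [B, G, I, L], [B,
   G, H, I], [G, H, I, L], [C, D, F, K], [C, D, J, K], [C, F, J, K], [C, E, F, J], [E, F, J, K],
   [C, D, H, L], [C, D, J, L], [C, H, J, L], [C, G, H, J], [G, H, J, L], [E, F, G, L], [E, F, K,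
   L], [F, G, K, L], [F, G, H, K], [G, H, K, L]]

/-- The masks of the faces of `Δ`. -/
def faceMasksΔ : List ℕ :=
  [0, 1, 2, 3, 4, 5, 6, 7, 8, 10, 12, 14, 16, 17, 18, 19, 20, 21, 22, 23, 32, 34, 36, 38, 40,
   42, 44, 46, 48, 50, 52, 54, 64, 65, 66, 67, 68, 69, 70, 71, 80, 81, 82, 83, 96, 98, 112, 114,
   128, 130, 132, 134, 136, 138, 140, 142, 160, 162, 192, 194, 196, 198, 224, 226, 256, 257,
   258, 259, 260, 262, 264, 266, 268, 270, 272, 274, 288, 290, 304, 306, 320, 322, 384, 386,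
   448, 450, 512, 513, 514, 515, 516, 517, 518, 519, 520, 524, 528, 532, 544, 548, 560, 564,
   576, 580, 640, 644, 704, 708, 768, 769, 770, 771, 772, 774, 776, 780, 1024, 1025, 1026, 1027,
   1028, 1032, 1036, 1040, 1041, 1042, 1043, 1056, 1060, 1064, 1068, 1072, 1088, 1120, 1152,
   1184, 1216, 1248, 1280, 1281, 1282, 1283, 1296, 1298, 1312, 1328, 1536, 1540, 1544, 1548,
   1552, 1568, 1572, 1584, 2048, 2049, 2050, 2051, 2052, 2056, 2060, 2064, 2080, 2096, 2112,
   2113, 2114, 2115, 2128, 2144, 2160, 2176, 2180, 2184, 2188, 2240, 2304, 2305, 2306, 2307,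
   2368, 2370, 2432, 2496, 2560, 2564, 2568, 2572, 2624, 2688, 2692, 2752, 3072, 3088, 3104,
   3120, 3136, 3168, 3200, 3264]

/-- The masks of the faces of `Γ`. -/
def faceMasksΓ : List ℕ := faceMasksΔ.filter fun m => m.blt 256

theorem hasFaceMasks_generated {S : Set (Finset (Fin 12))} {s : List (List (Fin 12))} {l : List ℕ}
    (hS : ∀ σ, σ ∈ S ↔ ∃ f ∈ s, f.toFinset = σ)
    (h1 : (s.all fun f => (subMasks f).all fun m => (maskSet l).testBit m) = true)
    (h2 : (l.all fun m => s.any fun f => maskLE m (mask f.toFinset)) = true) :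
    HasFaceMasks (generated S) l := by
  intro σ
  simp only [generated, mem_lowerClosure]
  constructor
  · rintro ⟨τ, hτ, hστ⟩
    obtain ⟨f, hf, rfl⟩ := (hS τ).1 hτ
    exact (testBit_maskSet l _).1
      (List.all_eq_true.1 (List.all_eq_true.1 h1 f hf) _ (mask_mem_subMasks hστ))
  · intro hσ
    obtain ⟨f, hf, hσf⟩ := List.any_eq_true.1 (List.all_eq_true.1 h2 _ hσ)
    exact ⟨f.toFinset, (hS _).2 ⟨f, hf, rfl⟩, maskLE_mask.1 hσf⟩

theorem mem_facetsΓ_iff (σ : Finset (Fin 12)) :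
    σ ∈ facetsΓ ↔ ∃ f ∈ facetListΓ, f.toFinset = σ := by
  simp [facetsΓ, facetListΓ, eq_comm (a := σ)]

theorem mem_otherFacetsΔ_iff (σ : Finset (Fin 12)) :
    σ ∈ otherFacetsΔ ↔ ∃ f ∈ otherFacetListΔ, f.toFinset = σ := by
  simp [otherFacetsΔ, otherFacetListΔ, eq_comm (a := σ)]

/-- The vertices `A` to `H` of `Γ` are the bits 0 to 7, so the masks below `256 = 2 ^ 8` are those
of the faces of `Δ` on these vertices. Hence this computation also shows that `Γ` is induced. -/
theorem hasFaceMasks_Γ : HasFaceMasks Γ faceMasksΓ :=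
  hasFaceMasks_generated mem_facetsΓ_iff (by decide +kernel) (by decide +kernel)

theorem hasFaceMasks_Δ : HasFaceMasks Δ faceMasksΔ := by
  refine hasFaceMasks_generated (s := facetListΓ ++ otherFacetListΔ) (fun σ => ?_)
    (by decide +kernel) (by decide +kernel)
  simp only [SetLike.mem_coe, Finset.mem_union, mem_facetsΓ_iff, mem_otherFacetsΔ_iff,
    List.mem_append, or_and_right, exists_or]

theorem lt_of_mem_faceMasksΔ : ∀ m ∈ faceMasksΔ, m < 4096 := by decide +kernel

theorem lt_of_mem_faceMasksΓ {m : ℕ} (hm : m ∈ faceMasksΓ) : m < 4096 :=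
  lt_of_mem_faceMasksΔ m (List.mem_of_mem_filter hm)

/-- Every facet of `Γ` contains `B`, so `Γ` and all vertex links except that of `B` are cones with
apex `B`. The link of `B` becomes a cone over `A` once `D`, `H` and `F` are removed. -/
theorem foldAcyclic_Γ (𝕜 : Type*) [Field 𝕜] : FoldAcyclic 𝕜 2 Γ :=
  foldAcyclic_two_of_reduces 𝕜 hasFaceMasks_Γ (fun _ => lt_of_mem_faceMasksΓ)
    [(0, [(0, B)]),
     (1, [(0, B)]),
     (2, [(8, C), (128, G), (32, E), (0, A)]),
     (4, [(0, B)]),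
     (8, [(0, B)]),
     (16, [(0, B)]),
     (32, [(0, B)]),
     (64, [(0, B)]),
     (128, [(0, B)])]
    (by decide +kernel) (by decide +kernel) (by decide +kernel)

theorem foldAcyclic_Δ (𝕜 : Type*) [Field 𝕜] : FoldAcyclic 𝕜 2 Δ :=
  foldAcyclic_two_of_reduces 𝕜 hasFaceMasks_Δ lt_of_mem_faceMasksΔ
    [(0, [(1, B), (8, C), (1026, E), (576, H), (18, F), (16, F), (512, C), (386, G),
       (130, G), (3072, G), (1024, F), (320, L), (384, L), (256, B), (2052, H), (128, G), (2048, G),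
       (0, B)]),
     (1, [(0, B)]),
     (2, [(8, C), (128, G), (320, L), (32, E), (272, K), (16, A), (64, A), (4, J), (0, A)]),
     (4, [(1, B), (64, H), (16, F), (514, I), (2, D), (128, L), (32, K), (0, D)]),
     (8, [(0, C)]),
     (16, [(1, B), (2048, F), (1026, I), (0, F)]),
     (32, [(128, G), (8, C), (2, E), (4, J), (64, L), (0, E)]),
     (64, [(5, B), (1, B), (16, F), (2050, I), (2, H), (32, K), (0, H)]),
     (128, [(8, C), (2052, J), (0, G)]),
     (256, [(1, B), (1024, E), (128, G), (8, C), (0, B)]),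
     (512, [(257, B), (8, C), (16, F), (64, H), (0, C)]),
     (1024, [(128, G), (8, C), (2048, F), (1, B), (2, E), (0, F)]),
     (2048, [(16, F), (8, C), (1024, G), (1, B), (4, H), (0, G)])]
    (by decide +kernel) (by decide +kernel) (by decide +kernel)

end BoolDecomp

namespace BoolDecomp

/-! ### Links -/

section Link

variable {V W : Type*} [DecidableEq V] [DecidableEq W]

theorem mem_link {K : Complex V} {σ τ : Finset V} :
    τ ∈ link K σ ↔ τ ∪ σ ∈ K ∧ τ ∩ σ = ∅ :=
  ⟨fun h => ⟨h.2.1, h.2.2⟩, fun h => ⟨K.lower Finset.subset_union_left h.1, h⟩⟩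

theorem mem_mapComplex {V W : Type*} {f : V ↪ W} {K : Complex V} {τ : Finset W} :
    τ ∈ mapComplex f K ↔ ∃ σ ∈ K, σ.map f = τ := Iff.rfl

theorem map_mem_mapComplex {V W : Type*} {f : V ↪ W} {K : Complex V} {σ : Finset V} :
    σ.map f ∈ mapComplex f K ↔ σ ∈ K := by
  simp [mem_mapComplex]

theorem link_mapComplex (f : V ↪ W) (K : Complex V) (σ : Finset V) :
    link (mapComplex f K) (σ.map f) = mapComplex f (link K σ) := by
  ext τ
  simp only [SetLike.mem_coe]
  constructor
  · intro h
    obtain ⟨τ, -, rfl⟩ := h.1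
    rw [mem_link, ← Finset.map_union, map_mem_mapComplex, ← Finset.map_inter,
      Finset.map_eq_empty] at h
    exact map_mem_mapComplex.2 (mem_link.2 h)
  · rintro ⟨τ, hτ, rfl⟩
    rw [mem_link, ← Finset.map_union, map_mem_mapComplex, ← Finset.map_inter, Finset.map_eq_empty]
    exact mem_link.1 hτ

theorem link_inf (M N : Complex V) (σ : Finset V) : link (M ⊓ N) σ = link M σ ⊓ link N σ := by
  ext τ
  simp only [SetLike.mem_coe, LowerSet.mem_inf_iff, mem_link]
  tauto

theorem mem_sup_univ {V ι : Type*} [Fintype ι] {M : ι → Complex V} {σ : Finset V} :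
    σ ∈ Finset.univ.sup M ↔ ∃ i, σ ∈ M i := by
  rw [Finset.sup_univ_eq_iSup, LowerSet.mem_iSup_iff]

theorem link_sup_univ {ι : Type*} [Fintype ι] (M : ι → Complex V) (σ : Finset V) :
    link (Finset.univ.sup M) σ = Finset.univ.sup fun i => link (M i) σ := by
  ext τ
  simp only [SetLike.mem_coe, mem_sup_univ, mem_link]
  exact exists_and_right.symm

end Link

/-! ### The complex `Γ` as an induced subcomplex of `Δ` -/

theorem mask_lt_two_pow_iff {σ : Finset (Fin 12)} {n : ℕ} :
    mask σ < 2 ^ n ↔ ∀ v ∈ σ, (v : ℕ) < n := by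
  constructor
  · intro h v hv
    by_contra! hn
    have h1 := testBit_mask_fin σ v
    rw [Nat.testBit_lt_two_pow (h.trans_le (Nat.pow_le_pow_right two_pos hn))] at h1
    simp [hv] at h1
  · intro h
    refine Nat.lt_pow_two_of_testBit _ fun i hi => ?_
    rw [testBit_mask, decide_eq_false_iff_not]
    rintro ⟨hi', hmem⟩
    exact (h _ hmem).not_ge hi

theorem mem_Γ_iff {σ : Finset (Fin 12)} : σ ∈ Γ ↔ σ ∈ Δ ∧ ∀ v ∈ σ, (v : ℕ) < 8 := by
  rw [hasFaceMasks_Γ, hasFaceMasks_Δ, faceMasksΓ, List.mem_filter, Nat.blt_eq,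
    ← mask_lt_two_pow_iff]
  norm_num

theorem Γ_le_Δ : Γ ≤ Δ := fun _ hσ => (mem_Γ_iff.1 hσ).1

theorem isInducedSubcomplex_Γ_Δ : IsInducedSubcomplex Γ Δ := by
  refine ⟨{v | (v : ℕ) < 8}, ?_⟩
  ext σ
  exact mem_Γ_iff

theorem singleton_mem_Γ_iff (v : Fin 12) : {v} ∈ Γ ↔ (v : ℕ) < 8 := by
  have hΔ : {v} ∈ Δ := by
    rw [hasFaceMasks_Δ, mask_singleton, ← maskMem_iff]
    revert v
    decide +kernel
  rw [mem_Γ_iff]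
  simp [hΔ]

theorem card_le_of_mem_Δ {σ : Finset (Fin 12)} (hσ : σ ∈ Δ) : σ.card ≤ 4 := by
  obtain ⟨τ, hτ, hστ⟩ := mem_lowerClosure.1 hσ
  refine (Finset.card_le_card hστ).trans ?_
  have h4 : ∀ f ∈ facetListΓ ++ otherFacetListΔ, f.length = 4 := by decide
  rw [SetLike.mem_coe, Finset.mem_union, mem_facetsΓ_iff, mem_otherFacetsΔ_iff] at hτ
  rcases hτ with ⟨f, hf, rfl⟩ | ⟨f, hf, rfl⟩
  · exact f.toFinset_card_le.trans (h4 f (List.mem_append_left _ hf)).le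
  · exact f.toFinset_card_le.trans (h4 f (List.mem_append_right _ hf)).le

/-! ### Copies of `Δ` -/

section Copies

variable {N : ℕ}

theorem copyVertex_of_lt (i : Fin N) {v : Fin 12} (hv : (v : ℕ) < 8) :
    copyVertex Γ N i v = Sum.inlₗ v := by
  rw [copyVertex, if_pos ((singleton_mem_Γ_iff v).2 hv)]

theorem copyVertex_of_le (i : Fin N) {v : Fin 12} (hv : 8 ≤ (v : ℕ)) :
    copyVertex Γ N i v = Sum.inrₗ (toLex (i, v)) := by
  rw [copyVertex, if_neg (mt (singleton_mem_Γ_iff v).1 hv.not_gt)]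

/-- The shared vertices `A` to `H` precede `I` to `L`, just as the left summand precedes the right
one. This lets `Acyclic.map` apply to the copies. -/
theorem copyVertex_strictMono (i : Fin N) : StrictMono (copyVertex Γ N i) := by
  intro u v huv
  have huv' : (u : ℕ) < v := huv
  rcases lt_or_ge (v : ℕ) 8 with hv | hv
  · rw [copyVertex_of_lt i hv, copyVertex_of_lt i (huv'.trans hv)]
    exact Sum.Lex.inl_lt_inl_iff.2 huv
  · rw [copyVertex_of_le i hv]
    rcases lt_or_ge (u : ℕ) 8 with hu | hu
    · rw [copyVertex_of_lt i hu]
      exact Sum.Lex.inl_lt_inr _ _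
    · rw [copyVertex_of_le i hu]
      refine Sum.Lex.inr_lt_inr_iff.2 (Prod.Lex.lt_iff.2 (Or.inr ⟨rfl, huv⟩))

/-- The embedding of the vertices of `Δ` as the vertices of the `i`-th copy. -/
noncomputable def copyEmb (i : Fin N) : Fin 12 ↪ Fin 12 ⊕ₗ (Fin N ×ₗ Fin 12) :=
  ⟨copyVertex Γ N i, (copyVertex_strictMono i).injective⟩

theorem copyEmb_of_lt (i : Fin N) {v : Fin 12} (hv : (v : ℕ) < 8) :
    copyEmb i v = Sum.inlₗ v := copyVertex_of_lt i hv

theorem copyEmb_of_le (i : Fin N) {v : Fin 12} (hv : 8 ≤ (v : ℕ)) :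
    copyEmb i v = Sum.inrₗ (toLex (i, v)) := copyVertex_of_le i hv

theorem copyEmb_eq_iff {i j : Fin N} {u v : Fin 12} :
    copyEmb i u = copyEmb j v ↔ u = v ∧ ((v : ℕ) < 8 ∨ i = j) := by
  rcases lt_or_ge (u : ℕ) 8 with hu | hu <;> rcases lt_or_ge (v : ℕ) 8 with hv | hv
  · rw [copyEmb_of_lt i hu, copyEmb_of_lt j hv, Sum.inlₗ, Sum.inlₗ, toLex_inj, Sum.inl.injEq]
    simp [hv]
  · rw [copyEmb_of_lt i hu, copyEmb_of_le j hv, Sum.inlₗ, Sum.inrₗ, toLex_inj]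
    simp only [reduceCtorEq, false_iff]
    rintro ⟨rfl, -⟩
    omega
  · rw [copyEmb_of_le i hu, copyEmb_of_lt j hv, Sum.inlₗ, Sum.inrₗ, toLex_inj]
    simp only [reduceCtorEq, false_iff]
    rintro ⟨rfl, -⟩
    omega
  · rw [copyEmb_of_le i hu, copyEmb_of_le j hv, Sum.inrₗ, Sum.inrₗ, toLex_inj, Sum.inr.injEq,
      toLex_inj, Prod.mk.injEq]
    simp [hv.not_gt, and_comm]

theorem map_copyEmb_of_mem_Γ {σ : Finset (Fin 12)} (hσ : σ ∈ Γ) (i j : Fin N) :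
    σ.map (copyEmb i) = σ.map (copyEmb j) := by
  rw [Finset.map_eq_image, Finset.map_eq_image]
  exact Finset.image_congr fun v hv =>
    copyEmb_eq_iff.2 ⟨rfl, Or.inl ((mem_Γ_iff.1 hσ).2 v hv)⟩

theorem exists_le_of_notMem_Γ {σ : Finset (Fin 12)} (hσ : σ ∈ Δ) (hσΓ : σ ∉ Γ) :
    ∃ v ∈ σ, 8 ≤ (v : ℕ) := by
  by_contra! h
  exact hσΓ (mem_Γ_iff.2 ⟨hσ, h⟩)

/-- A face outside `Γ` has a vertex among `I` to `L`, and the image of that vertex records the index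
of the copy. -/
theorem eq_of_map_copyEmb_subset {i j : Fin N} {σ τ : Finset (Fin 12)} (hσ : σ ∈ Δ)
    (hσΓ : σ ∉ Γ) (h : σ.map (copyEmb i) ⊆ τ.map (copyEmb j)) : i = j := by
  obtain ⟨v, hv, hv8⟩ := exists_le_of_notMem_Γ hσ hσΓ
  obtain ⟨u, -, huv⟩ := Finset.mem_map.1 (h (Finset.mem_map_of_mem _ hv))
  obtain ⟨rfl, h | h⟩ := copyEmb_eq_iff.1 huv
  · omega
  · exact h.symm

/-- The `i`-th copy of `Δ`. -/
noncomputable def copyΔ (i : Fin N) : Complex (Fin 12 ⊕ₗ (Fin N ×ₗ Fin 12)) :=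
  mapComplex (copyEmb i) Δ

theorem mem_Ω_iff {σ : Finset (Fin 12 ⊕ₗ (Fin N ×ₗ Fin 12))} :
    σ ∈ Ω N ↔ ∃ i : Fin N, ∃ τ ∈ Δ, σ = τ.map (copyEmb i) := by
  simp only [Finset.map_eq_image]
  rfl

theorem Ω_eq_sup (N : ℕ) : Ω N = Finset.univ.sup (copyΔ (N := N)) := by
  ext σ
  rw [SetLike.mem_coe, SetLike.mem_coe, mem_sup_univ, mem_Ω_iff]
  simp only [copyΔ, mem_mapComplex, eq_comm]

/-- The index `k` is arbitrary, since all copies embed `Γ` in the same way. -/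
theorem copyΔ_inf_copyΔ {i j k : Fin N} (hij : i ≠ j) :
    copyΔ i ⊓ copyΔ j = mapComplex (copyEmb k) Γ := by
  ext σ
  simp only [SetLike.mem_coe, LowerSet.mem_inf_iff]
  constructor
  · rintro ⟨⟨τ, hτ, rfl⟩, ⟨ρ, hρ, h⟩⟩
    have hτΓ : τ ∈ Γ := by
      by_contra hτΓ
      exact hij (eq_of_map_copyEmb_subset hτ hτΓ h.ge)
    exact ⟨τ, hτΓ, map_copyEmb_of_mem_Γ hτΓ k i⟩
  · rintro ⟨τ, hτ, rfl⟩
    exact ⟨⟨τ, Γ_le_Δ hτ, map_copyEmb_of_mem_Γ hτ i k⟩, ⟨τ, Γ_le_Δ hτ, map_copyEmb_of_mem_Γ hτ j k⟩⟩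

theorem foldAcyclic_Ω (𝕜 : Type*) [Field 𝕜] (N : ℕ) : FoldAcyclic 𝕜 2 (Ω N) := by
  intro σ hσ hcard
  obtain ⟨i, τ, hτ, rfl⟩ := mem_Ω_iff.1 hσ
  rw [Finset.card_map] at hcard
  have hmap : ∀ j : Fin N, Acyclic 𝕜 (mapComplex (copyEmb j) (link Δ τ)) := fun j =>
    (foldAcyclic_Δ 𝕜 τ hτ hcard).map 𝕜 _ (copyVertex_strictMono j)
  rw [Ω_eq_sup, link_sup_univ]
  -- For `τ` in `Γ`, the links in the copies meet pairwise in the acyclic link in `Γ`. Otherwise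
  -- only the copy containing `τ` contributes to the link.
  by_cases hτΓ : τ ∈ Γ
  · refine acyclic_finset_sup 𝕜 (N := mapComplex (copyEmb i) (link Γ τ))
      ((foldAcyclic_Γ 𝕜 τ hτΓ hcard).map 𝕜 _ (copyVertex_strictMono i)) (fun j => ?_)
      (fun j k hjk => ?_) ⟨i, Finset.mem_univ i⟩
    · rw [map_copyEmb_of_mem_Γ hτΓ i j, copyΔ, link_mapComplex]
      exact hmap j
    · rw [← link_inf, copyΔ_inf_copyΔ (k := i) hjk, link_mapComplex]
  · convert hmap i using 1
    apply le_antisymm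
    · refine Finset.sup_le fun j _ ρ hρ => ?_
      obtain ⟨⟨π, -, hπ⟩, -⟩ := mem_link.1 hρ
      obtain rfl : i = j := eq_of_map_copyEmb_subset hτ hτΓ
        (Finset.subset_union_right.trans hπ.ge)
      rwa [copyΔ, link_mapComplex] at hρ
    · intro ρ hρ
      refine mem_sup_univ.2 ⟨i, ?_⟩
      rwa [copyΔ, link_mapComplex]

theorem hasDim_Ω (hN : 0 < N) : HasDim (Ω N) 3 := by
  constructor
  · refine ⟨Finset.map (copyEmb ⟨0, hN⟩) {A, B, C, E}, mem_Ω_iff.2 ⟨_, _, ?_, rfl⟩, ?_⟩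
    · exact subset_lowerClosure (by simp [facetsΓ])
    · rw [Finset.card_map]
      rfl
  · rintro _ ⟨σ, hσ, rfl⟩
    obtain ⟨i, τ, hτ, rfl⟩ := mem_Ω_iff.1 hσ
    have := card_le_of_mem_Δ hτ
    rw [Finset.card_map]
    omega

end Copies

end BoolDecomp

namespace BoolDecomp

/-! ### The relative complex `Δ \ Γ` has no decomposition -/

/-- The masks of the two-element sets of vertices. -/
def pairMasks : List ℕ :=
  (List.finRange 12).flatMap fun a : Fin 12 =>
    ((List.finRange 12).filter (a < ·)).map fun b : Fin 12 =>
      (Nat.shiftLeft 1 a).lor (Nat.shiftLeft 1 b)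

theorem mask_mem_pairMasks {σ : Finset (Fin 12)} (hσ : σ.card = 2) : mask σ ∈ pairMasks := by
  have h : ∀ a b : Fin 12, a < b → mask {a, b} ∈ pairMasks := by
    intro a b hab
    rw [mask_insert, mask_singleton, mask_singleton]
    rw [pairMasks, List.mem_flatMap]
    refine ⟨a, List.mem_finRange a, ?_⟩
    rw [List.mem_map]
    exact ⟨b, List.mem_filter.2 ⟨List.mem_finRange b, decide_eq_true hab⟩, rfl⟩
  obtain ⟨a, b, hab, rfl⟩ := Finset.card_eq_two.1 hσ
  rcases lt_or_gt_of_ne hab with h' | h'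
  · exact h a b h'
  · rw [Finset.pair_comm]
    exact h b a h'

/-- The rank two boolean intervals of `Δ \ Γ`, given by the masks of their end points. -/
def intervalMasks : List (ℕ × ℕ) :=
  (faceMasksΔ.filter (Nat.ble 256)).flatMap fun x =>
    (pairMasks.filter fun p => (x.land p).beq 0 && (maskSet faceMasksΔ).testBit (x.lor p)).map
      fun p => (x, x.lor p)

theorem notMem_Γ_iff_mask {σ : Finset (Fin 12)} (hσ : σ ∈ Δ) : σ ∉ Γ ↔ 256 ≤ mask σ := by
  rw [hasFaceMasks_Γ, faceMasksΓ, List.mem_filter, ← hasFaceMasks_Δ, Nat.blt_eq, not_and, not_lt]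
  exact ⟨fun h => h hσ, fun h _ => h⟩

theorem mask_mem_intervalMasks {σ τ : Finset (Fin 12)} (hστ : σ ⊆ τ) (hcard : τ.card = σ.card + 2)
    (hτ : τ ∈ Δ) (hσ : σ ∉ Γ) : (mask σ, mask τ) ∈ intervalMasks := by
  have hσΔ : σ ∈ Δ := Δ.lower hστ hτ
  have hor : (mask σ).lor (mask (τ \ σ)) = mask τ := by
    change mask σ ||| mask (τ \ σ) = mask τ
    rw [← mask_union, Finset.union_sdiff_of_subset hστ]
  have hand : (mask σ).land (mask (τ \ σ)) = 0 := by
    change mask σ &&& mask (τ \ σ) = 0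
    rw [← mask_inter, Finset.inter_sdiff_self, mask_empty]
  refine List.mem_flatMap.2 ⟨mask σ, List.mem_filter.2 ⟨(hasFaceMasks_Δ σ).1 hσΔ, ?_⟩,
    List.mem_map.2 ⟨mask (τ \ σ), List.mem_filter.2 ⟨mask_mem_pairMasks ?_, ?_⟩, by rw [hor]⟩⟩
  · exact Nat.ble_eq_true_of_le ((notMem_Γ_iff_mask hσΔ).1 hσ)
  · rw [Finset.card_sdiff_of_subset hστ]
    omega
  · rw [Bool.and_eq_true, hor, hand, testBit_maskSet, ← hasFaceMasks_Δ]
    exact ⟨rfl, hτ⟩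

/-- The set with mask `f` lies in the interval `c`. -/
def coversMask (f : ℕ) (c : ℕ × ℕ) : Bool := maskLE c.1 f && maskLE f c.2

/-- The intervals `c` and `d` are equal or disjoint. -/
def compatible (c d : ℕ × ℕ) : Bool :=
  c.1.beq d.1 && c.2.beq d.2 || !maskLE (c.1.lor d.1) (c.2.land d.2)

/-- Exhaustive search: each number in the first argument is the mask of a face of `Δ \ Γ` on whose
covering interval the search branches; the second argument is the stack of open branches, each given
by the intervals that are still available. The result is `true` if all branches are refuted. -/
def refutesCovers : List ℕ → List (List (ℕ × ℕ)) → Bool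
  | _, [] => true
  | [], _ :: _ => false
  | f :: fs, l :: st =>
    (maskSet faceMasksΔ).testBit f && Nat.ble 256 f &&
      refutesCovers fs ((l.filter (coversMask f)).map (fun c => l.filter (compatible c)) ++ st)

/-- A cover of the faces of `Δ` outside `Γ` by disjoint intervals. -/
structure IsRelativeCover (S : Set (Finset (Fin 12) × Finset (Fin 12))) : Prop where
  subset : ∀ p ∈ S, p.1 ⊆ p.2
  eq : ∀ p ∈ S, ∀ q ∈ S, ∀ σ, p.1 ⊆ σ → σ ⊆ p.2 → q.1 ⊆ σ → σ ⊆ q.2 → p = q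
  cover : ∀ σ ∈ Δ, σ ∉ Γ → ∃ p ∈ S, p.1 ⊆ σ ∧ σ ⊆ p.2

theorem IsRelativeCover.compatible {S : Set (Finset (Fin 12) × Finset (Fin 12))}
    (hS : IsRelativeCover S) {p q : Finset (Fin 12) × Finset (Fin 12)} (hp : p ∈ S) (hq : q ∈ S) :
    compatible (mask p.1, mask p.2) (mask q.1, mask q.2) = true := by
  by_cases hpq : p = q
  · simp [BoolDecomp.compatible, hpq]
  · rw [BoolDecomp.compatible, Bool.or_eq_true, Bool.not_eq_true', Bool.eq_false_iff]
    right
    intro h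
    change maskLE (mask p.1 ||| mask q.1) (mask p.2 &&& mask q.2) = true at h
    rw [← mask_union, ← mask_inter, maskLE_mask, Finset.subset_inter_iff] at h
    -- If two intervals meet at all, they meet in the union of their bottoms.
    exact hpq (hS.eq p hp q hq (p.1 ∪ q.1) Finset.subset_union_left h.1 Finset.subset_union_right
      h.2)

/-- The invariant is that some open branch still lists all intervals of `S`. The branching face is
covered by some `p ∈ S`, and the branch choosing `p` keeps all of `S`, since its members are
pairwise compatible. A search that closes every branch contradicts this. -/
theorem not_isRelativeCover_of_refutesCovers {S : Set (Finset (Fin 12) × Finset (Fin 12))}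
    {fs : List ℕ} {st : List (List (ℕ × ℕ))} (h : refutesCovers fs st = true)
    {l : List (ℕ × ℕ)} (hl : l ∈ st) (hSl : ∀ p ∈ S, (mask p.1, mask p.2) ∈ l) :
    ¬ IsRelativeCover S := by
  intro hS
  induction fs generalizing st l with
  | nil =>
    cases st with
    | nil => simp at hl
    | cons a st => simp [refutesCovers] at h
  | cons f fs ih =>
    cases st with
    | nil => simp at hl
    | cons a st =>
      rw [refutesCovers, Bool.and_eq_true, Bool.and_eq_true, testBit_maskSet, Nat.ble_eq] at h
      obtain ⟨⟨hf, hf'⟩, h⟩ := h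
      rcases List.mem_cons.1 hl with rfl | hl
      · obtain ⟨σ, rfl⟩ := exists_mask_eq (lt_of_mem_faceMasksΔ f hf)
        have hσΔ := (hasFaceMasks_Δ σ).2 hf
        obtain ⟨p, hp, hpσ, hσp⟩ := hS.cover σ hσΔ ((notMem_Γ_iff_mask hσΔ).2 hf')
        refine ih h (l := l.filter (BoolDecomp.compatible (mask p.1, mask p.2)))
          (List.mem_append_left _ (List.mem_map.2 ⟨_, List.mem_filter.2 ⟨hSl p hp, ?_⟩, rfl⟩))
          (fun q hq => List.mem_filter.2 ⟨hSl q hq, hS.compatible hp hq⟩)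
        rw [coversMask, Bool.and_eq_true]
        exact ⟨maskLE_mask.2 hpσ, maskLE_mask.2 hσp⟩
      · exact ih h (List.mem_append_right _ hl) hSl

/-- With bottoms outside `Γ`, the intervals lie entirely in `Δ \ Γ`, so they are among the finitely
many in `intervalMasks`. The numbers are the branching faces in depth-first order; a face with no
remaining covering interval closes its branch. -/
theorem not_isRelativeCover {S : Set (Finset (Fin 12) × Finset (Fin 12))}
    (hcard : ∀ p ∈ S, p.2.card = p.1.card + 2) (hΔ : ∀ p ∈ S, p.2 ∈ Δ) (hΓ : ∀ p ∈ S, p.1 ∉ Γ) :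
    ¬ IsRelativeCover S := by
  have h : refutesCovers
      [290, 266, 386, 260, 780, 320, 2496, 2184, 2572, 2052, 386, 322, 2496, 266, 2184, 2180, 262,
       2572, 776, 272, 386, 320, 2496, 266, 262, 780, 2184, 2572, 2052, 1312, 274, 1184, 386, 322,
       1120, 2496, 3200, 1328, 1064, 1184, 1120, 3264, 1060, 2184, 1548, 2568, 2052]
      [intervalMasks] = true := by
    decide +kernel
  intro hS
  exact not_isRelativeCover_of_refutesCovers h (List.mem_singleton.2 rfl)
    (fun p hp => mask_mem_intervalMasks (hS.subset p hp) (hcard p hp) (hΔ p hp) (hΓ p hp)) hS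

/-! ### Counting faces -/

open Classical in
theorem HasFaceMasks.card_filter {K : Complex (Fin 12)} {l : List ℕ} (hl : HasFaceMasks K l)
    (hnd : l.Nodup) (hlt : ∀ m ∈ l, m < 4096) :
    (Finset.univ.filter (· ∈ K)).card = l.length := by
  rw [← List.toFinset_card_of_nodup hnd, ← Finset.card_image_of_injective _ mask_injective]
  congr 1
  ext m
  simp only [Finset.mem_image, Finset.mem_filter, Finset.mem_univ, true_and, List.mem_toFinset]
  constructor
  · rintro ⟨σ, hσ, rfl⟩
    exact (hl σ).1 hσ
  · intro hm
    obtain ⟨σ, rfl⟩ := exists_mask_eq (hlt m hm)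
    exact ⟨σ, (hl σ).2 hm, rfl⟩

theorem nodup_faceMasksΔ : faceMasksΔ.Nodup := by
  have h : faceMasksΔ.IsChain (· < ·) := by decide +kernel
  exact (List.isChain_iff_pairwise.1 h).nodup

open Classical in
theorem card_faces_Δ : (Finset.univ.filter (· ∈ Δ)).card = 200 :=
  (hasFaceMasks_Δ.card_filter nodup_faceMasksΔ lt_of_mem_faceMasksΔ).trans (by decide +kernel)

open Classical in
theorem card_faces_Γ : (Finset.univ.filter (· ∈ Γ)).card = 64 :=
  (hasFaceMasks_Γ.card_filter (nodup_faceMasksΔ.filter _) fun _ => lt_of_mem_faceMasksΓ).trans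
    (by decide +kernel)

open Classical in
theorem card_faces_Δ_sdiff_Γ : (Finset.univ.filter fun σ => σ ∈ Δ ∧ σ ∉ Γ).card = 136 := by
  have h : (Finset.univ.filter fun σ => σ ∈ Δ ∧ σ ∉ Γ) =
      Finset.univ.filter (· ∈ Δ) \ Finset.univ.filter (· ∈ Γ) := by
    ext σ
    simp
  rw [h, Finset.card_sdiff_of_subset, card_faces_Δ, card_faces_Γ]
  intro σ hσ
  simp only [Finset.mem_filter, Finset.mem_univ, true_and] at hσ ⊢
  exact Γ_le_Δ hσ

/-! ### Boolean intervals in face posets -/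

/-- The faces of `K` between `X` and `Y`. -/
def faceInterval {V : Type*} (K : Complex V) (X Y : Finset V) : Set K :=
  {σ | X ⊆ σ.1 ∧ σ.1 ⊆ Y}

theorem IsBooleanInterval.exists_eq_faceInterval {V : Type*} {K : Complex V} {I : Set K}
    (hI : IsBooleanInterval 2 I) :
    ∃ X Y, Y ∈ K ∧ X ⊆ Y ∧ Y.card = X.card + 2 ∧ I = faceInterval K X Y := by
  classical
  obtain ⟨⟨x, y, rfl⟩, ⟨e⟩⟩ := hI
  have hxy : x.1 ⊆ y.1 := (e.symm ∅).2.1.trans (e.symm ∅).2.2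
  refine ⟨x.1, y.1, y.2, hxy, ?_, rfl⟩
  -- The rank is read off from cardinality: between `x` and `y` there are `2 ^ (|y| - |x|)` faces.
  have h1 : (Set.Icc x y).ncard = 4 := by
    rw [← Nat.card_coe_set_eq, Nat.card_congr e.toEquiv]
    simp
  have h2 : Subtype.val '' Set.Icc x y = (Finset.Icc x.1 y.1 : Set (Finset V)) := by
    ext σ
    simp only [Set.mem_image, Finset.coe_Icc, Set.mem_Icc]
    constructor
    · rintro ⟨τ, hτ, rfl⟩
      exact hτ
    · intro hσ
      exact ⟨⟨σ, K.lower hσ.2 y.2⟩, hσ, rfl⟩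
  rw [← Set.ncard_image_of_injective _ Subtype.val_injective, h2, Set.ncard_coe_finset,
    Finset.card_Icc_finset hxy, show 4 = 2 ^ 2 from rfl] at h1
  have := Nat.pow_right_injective le_rfl h1
  have := Finset.card_le_card hxy
  omega

theorem faceInterval_injective {V : Type*} {K : Complex V} {X Y X' Y' : Finset V} (hY : Y ∈ K)
    (hXY : X ⊆ Y) (hY' : Y' ∈ K) (hXY' : X' ⊆ Y')
    (h : faceInterval K X Y = faceInterval K X' Y') : X = X' ∧ Y = Y' := by
  have hX : X ∈ K := K.lower hXY hY
  have hX' : X' ∈ K := K.lower hXY' hY'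
  have h1 : (⟨X, hX⟩ : K) ∈ faceInterval K X' Y' := h ▸ ⟨subset_rfl, hXY⟩
  have h2 : (⟨Y, hY⟩ : K) ∈ faceInterval K X' Y' := h ▸ ⟨hXY, subset_rfl⟩
  have h3 : (⟨X', hX'⟩ : K) ∈ faceInterval K X Y := h ▸ ⟨subset_rfl, hXY'⟩
  have h4 : (⟨Y', hY'⟩ : K) ∈ faceInterval K X Y := h ▸ ⟨hXY', subset_rfl⟩
  exact ⟨h3.1.antisymm h1.1, h2.2.antisymm h4.2⟩

/-! ### Decompositions of `Ω` -/

section Decomposition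

variable {N : ℕ} (𝓑 : Set (Set (Ω N)))

/-- The intervals of a decomposition whose top lies in the `i`-th copy of `Δ`, but not in `Γ`. -/
noncomputable def copyIntervals (i : Fin N) : Finset (Finset (Fin 12) × Finset (Fin 12)) :=
  (Set.toFinite {p | p.1 ⊆ p.2 ∧ p.2.card = p.1.card + 2 ∧ p.2 ∈ Δ ∧ p.2 ∉ Γ ∧
    faceInterval (Ω N) (p.1.map (copyEmb i)) (p.2.map (copyEmb i)) ∈ 𝓑}).toFinset

theorem mem_copyIntervals {i : Fin N} {p : Finset (Fin 12) × Finset (Fin 12)} :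
    p ∈ copyIntervals 𝓑 i ↔ p.1 ⊆ p.2 ∧ p.2.card = p.1.card + 2 ∧ p.2 ∈ Δ ∧ p.2 ∉ Γ ∧
      faceInterval (Ω N) (p.1.map (copyEmb i)) (p.2.map (copyEmb i)) ∈ 𝓑 := by
  rw [copyIntervals, Set.Finite.mem_toFinset]
  rfl

variable {𝓑}

/-- Disjointness in the decomposition, transported to `Δ`. It is used with `i = j`, and with `i ≠ j`
for faces `σ` of `Γ`, which have the same image in all copies. -/
theorem map_eq_map_of_mem_copyIntervals (h𝓑 : IsBooleanDecomposition 2 𝓑) {i j : Fin N}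
    {p q : Finset (Fin 12) × Finset (Fin 12)} (hp : p ∈ copyIntervals 𝓑 i)
    (hq : q ∈ copyIntervals 𝓑 j) {σ : Finset (Fin 12)} (hp1 : p.1 ⊆ σ) (hp2 : σ ⊆ p.2)
    (hq1 : q.1 ⊆ σ) (hq2 : σ ⊆ q.2) (hσ : σ.map (copyEmb i) = σ.map (copyEmb j)) :
    p.1.map (copyEmb i) = q.1.map (copyEmb j) ∧ p.2.map (copyEmb i) = q.2.map (copyEmb j) := by
  rw [mem_copyIntervals] at hp hq
  obtain ⟨hp, -, hpΔ, -, hpB⟩ := hp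
  obtain ⟨hq, -, hqΔ, -, hqB⟩ := hq
  refine faceInterval_injective (mem_Ω_iff.2 ⟨i, _, hpΔ, rfl⟩) (Finset.map_subset_map.2 hp)
    (mem_Ω_iff.2 ⟨j, _, hqΔ, rfl⟩) (Finset.map_subset_map.2 hq) ?_
  by_contra hne
  let σ' : Ω N := ⟨σ.map (copyEmb i), mem_Ω_iff.2 ⟨i, σ, Δ.lower hp2 hpΔ, rfl⟩⟩
  have hσp : σ' ∈ faceInterval (Ω N) (p.1.map (copyEmb i)) (p.2.map (copyEmb i)) :=
    ⟨Finset.map_subset_map.2 hp1, Finset.map_subset_map.2 hp2⟩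
  refine Set.disjoint_left.1 (h𝓑.2.1 hpB hqB hne) hσp ⟨?_, ?_⟩
  · exact (Finset.map_subset_map.2 hq1).trans hσ.ge
  · exact hσ.le.trans (Finset.map_subset_map.2 hq2)

theorem isRelativeCover_copyIntervals (h𝓑 : IsBooleanDecomposition 2 𝓑) (i : Fin N) :
    IsRelativeCover (copyIntervals 𝓑 i : Set (Finset (Fin 12) × Finset (Fin 12))) where
  subset p hp := ((mem_copyIntervals 𝓑).1 hp).1
  eq p hp q hq σ hp1 hp2 hq1 hq2 := by
    obtain ⟨h1, h2⟩ := map_eq_map_of_mem_copyIntervals h𝓑 hp hq hp1 hp2 hq1 hq2 rfl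
    exact Prod.ext (Finset.map_injective _ h1) (Finset.map_injective _ h2)
  cover σ hσ hσΓ := by
    have hmem : (⟨σ.map (copyEmb i), mem_Ω_iff.2 ⟨i, σ, hσ, rfl⟩⟩ : Ω N) ∈ ⋃₀ 𝓑 := by
      rw [h𝓑.2.2]
      trivial
    obtain ⟨I, hI, hσI⟩ := hmem
    obtain ⟨X, Y, hY, hXY, hcard, rfl⟩ := (h𝓑.1 I hI).exists_eq_faceInterval
    obtain ⟨j, y, hy, rfl⟩ := mem_Ω_iff.1 hY
    -- The top contains a face of copy `i` outside `Γ`, so it belongs to that copy.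
    obtain rfl : i = j := eq_of_map_copyEmb_subset hσ hσΓ hσI.2
    obtain ⟨x, hxy, rfl⟩ := Finset.subset_map_iff.1 hXY
    rw [Finset.card_map, Finset.card_map] at hcard
    have hσy : σ ⊆ y := Finset.map_subset_map.1 hσI.2
    exact ⟨(x, y), (mem_copyIntervals 𝓑).2 ⟨hxy, hcard, hy, fun h => hσΓ (Γ.lower hσy h), hI⟩,
      Finset.map_subset_map.1 hσI.1, hσy⟩

open Classical in
/-- The faces of `Γ` in the intervals whose top lies in the `i`-th copy of `Δ`, but not in `Γ`. -/
noncomputable def usedFaces (𝓑 : Set (Set (Ω N))) (i : Fin N) : Finset (Finset (Fin 12)) :=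
  ((copyIntervals 𝓑 i).biUnion fun p => Finset.Icc p.1 p.2).filter (· ∈ Γ)

theorem mem_usedFaces {i : Fin N} {σ : Finset (Fin 12)} :
    σ ∈ usedFaces 𝓑 i ↔ (∃ p ∈ copyIntervals 𝓑 i, p.1 ⊆ σ ∧ σ ⊆ p.2) ∧ σ ∈ Γ := by
  simp [usedFaces]

/-- The intervals are disjoint with 4 faces each, and their faces outside `Γ` are exactly the 136
faces of `Δ \ Γ`; 4 divides 136. -/
theorem four_dvd_card_usedFaces (h𝓑 : IsBooleanDecomposition 2 𝓑) (i : Fin N) :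
    4 ∣ (usedFaces 𝓑 i).card := by
  classical
  have hS := isRelativeCover_copyIntervals h𝓑 i
  have h1 : ((copyIntervals 𝓑 i).biUnion fun p => Finset.Icc p.1 p.2).card =
      (copyIntervals 𝓑 i).card * 4 := by
    rw [Finset.card_biUnion]
    · refine Finset.sum_const_nat fun p hp => ?_
      obtain ⟨hsub, hcard, -⟩ := (mem_copyIntervals 𝓑).1 hp
      rw [Finset.card_Icc_finset hsub, hcard, Nat.add_sub_cancel_left]
      norm_num
    · intro p hp q hq hpq
      refine Finset.disjoint_left.2 fun σ hσp hσq => hpq ?_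
      rw [Finset.mem_Icc] at hσp hσq
      exact hS.eq p hp q hq σ hσp.1 hσp.2 hσq.1 hσq.2
  have h2 : ((copyIntervals 𝓑 i).biUnion fun p => Finset.Icc p.1 p.2).filter (¬ · ∈ Γ) =
      Finset.univ.filter fun σ => σ ∈ Δ ∧ σ ∉ Γ := by
    ext σ
    simp only [Finset.mem_filter, Finset.mem_biUnion, Finset.mem_Icc, Finset.mem_univ, true_and]
    refine and_congr_left fun hσΓ => ⟨?_, fun hσ => hS.cover σ hσ hσΓ⟩
    rintro ⟨p, hp, -, hσp⟩
    exact Δ.lower hσp ((mem_copyIntervals 𝓑).1 hp).2.2.1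
  have h3 := Finset.card_filter_add_card_filter_not
    (s := (copyIntervals 𝓑 i).biUnion fun p => Finset.Icc p.1 p.2) (· ∈ Γ)
  rw [h2, card_faces_Δ_sdiff_Γ, h1] at h3
  change (usedFaces 𝓑 i).card + 136 = _ at h3
  omega

/-- A face used by both copies would force their intervals through it to coincide, but the top lies
outside `Γ` and determines its copy. -/
theorem disjoint_usedFaces (h𝓑 : IsBooleanDecomposition 2 𝓑) {i j : Fin N} (hij : i ≠ j) :
    Disjoint (usedFaces 𝓑 i) (usedFaces 𝓑 j) := by
  refine Finset.disjoint_left.2 fun σ hi hj => hij ?_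
  obtain ⟨⟨p, hp, hp1, hp2⟩, hσ⟩ := mem_usedFaces.1 hi
  obtain ⟨⟨q, hq, hq1, hq2⟩, -⟩ := mem_usedFaces.1 hj
  obtain ⟨-, h⟩ := map_eq_map_of_mem_copyIntervals h𝓑 hp hq hp1 hp2 hq1 hq2
    (map_copyEmb_of_mem_Γ hσ i j)
  obtain ⟨-, -, hpΔ, hpΓ, -⟩ := (mem_copyIntervals 𝓑).1 hp
  exact eq_of_map_copyEmb_subset hpΔ hpΓ h.le

/-- If no face of `Γ` is used, no bottom lies in `Γ`, and the intervals partition `Δ \ Γ`, contrary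
to `not_isRelativeCover`. -/
theorem nonempty_usedFaces (h𝓑 : IsBooleanDecomposition 2 𝓑) (i : Fin N) :
    (usedFaces 𝓑 i).Nonempty := by
  by_contra hempty
  refine not_isRelativeCover (fun p hp => ((mem_copyIntervals 𝓑).1 hp).2.1)
    (fun p hp => ((mem_copyIntervals 𝓑).1 hp).2.2.1) (fun p hp hpΓ => hempty ?_)
    (isRelativeCover_copyIntervals h𝓑 i)
  exact ⟨p.1, mem_usedFaces.2 ⟨⟨p, hp, subset_rfl, ((mem_copyIntervals 𝓑).1 hp).1⟩, hpΓ⟩⟩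

theorem not_isBooleanDecomposition_Ω (hN : 16 < N) (𝓑 : Set (Set (Ω N))) :
    ¬ IsBooleanDecomposition 2 𝓑 := by
  classical
  intro h𝓑
  have h1 : ∑ i : Fin N, (usedFaces 𝓑 i).card ≤ 64 := by
    rw [← Finset.card_biUnion fun i _ j _ hij => disjoint_usedFaces h𝓑 hij, ← card_faces_Γ]
    refine Finset.card_le_card fun σ hσ => ?_
    obtain ⟨i, -, hi⟩ := Finset.mem_biUnion.1 hσ
    exact Finset.mem_filter.2 ⟨Finset.mem_univ σ, (mem_usedFaces.1 hi).2⟩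
  have h2 : ∑ _i : Fin N, 4 ≤ ∑ i : Fin N, (usedFaces 𝓑 i).card :=
    Finset.sum_le_sum fun i _ => Nat.le_of_dvd (Finset.card_pos.2 (nonempty_usedFaces h𝓑 i))
      (four_dvd_card_usedFaces h𝓑 i)
  rw [Finset.sum_const, Finset.card_univ, Fintype.card_fin, smul_eq_mul] at h2
  omega

end Decomposition

end BoolDecomp

namespace BoolDecomp

/-! ### Stellar subdivisions -/

theorem mem_realization_iff {V : Type*} [Fintype V] {K : Complex V} {x : V → ℝ} :
    x ∈ realization K ↔ x ∈ stdSimplex ℝ V ∧ ∃ τ ∈ K, ∀ v, x v ≠ 0 → v ∈ τ := by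
  classical
  refine and_congr_right fun _ => ⟨?_, ?_⟩
  · rintro ⟨τ, hτ, h⟩
    exact ⟨τ, hτ, fun v => (h v).2⟩
  · rintro ⟨τ, hτ, h⟩
    refine ⟨Finset.univ.filter (x · ≠ 0), K.lower (fun v hv => h v ?_) hτ, by simp⟩
    simpa using hv

section Stellar

variable {V : Type*} [DecidableEq V]

/-- Replace the vertex `w` by the barycenter of `σ`. -/
noncomputable def spread (σ : Finset V) (w : V) (x : V → ℝ) (v : V) : ℝ :=
  x v + (if v ∈ σ then x w / σ.card else 0) - if v = w then x w else 0

/-- Write a point as a combination of the barycenter of `σ`, now denoted by the vertex `w`, and of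
points in the boundary of `σ`. -/
noncomputable def collect {σ : Finset V} (hσ : σ.Nonempty) (w : V) (y : V → ℝ) (v : V) : ℝ :=
  y v - (if v ∈ σ then σ.inf' hσ y else 0) + if v = w then σ.card * σ.inf' hσ y else 0

theorem continuous_spread (σ : Finset V) (w : V) : Continuous (spread σ w) := by
  refine continuous_pi fun v => ?_
  unfold spread
  split_ifs <;> fun_prop

theorem continuous_collect {σ : Finset V} (hσ : σ.Nonempty) (w : V) :
    Continuous (collect hσ w) := by
  have h : Continuous fun y : V → ℝ => σ.inf' hσ y :=
    Continuous.finset_inf'_apply hσ fun v _ => continuous_apply v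
  refine continuous_pi fun v => ?_
  unfold collect
  split_ifs <;> fun_prop

theorem spread_collect {σ : Finset V} {w : V} (hσ : σ.Nonempty) (hwσ : w ∉ σ) {y : V → ℝ} (hyw : y w = 0) :
    spread σ w (collect hσ w y) = y := by
  have hcard : (σ.card : ℝ) ≠ 0 := by exact_mod_cast hσ.card_ne_zero
  ext v
  simp only [spread, collect, hyw, hwσ, if_false, if_true, sub_zero, zero_add]
  rw [mul_div_cancel_left₀ _ hcard]
  split_ifs <;> ring

/-- The facets of the stellar subdivision of the complex with facets `S` at a face `σ` that lies
in a single facet `F`, with the new vertex `w`. -/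
def stellarFacets (S : Finset (Finset V)) (F σ : Finset V) (w : V) : Finset (Finset V) :=
  S.erase F ∪ σ.image fun v => insert w (F.erase v)

theorem mem_generated_stellarFacets {S : Finset (Finset V)} {F σ τ : Finset V} {w : V} :
    τ ∈ generated (stellarFacets S F σ w : Set (Finset V)) ↔
      (∃ F' ∈ S, F' ≠ F ∧ τ ⊆ F') ∨ ∃ v ∈ σ, τ ⊆ insert w (F.erase v) := by
  simp only [generated, mem_lowerClosure, stellarFacets, SetLike.mem_coe, Finset.mem_union,
    Finset.mem_erase, Finset.mem_image]
  constructor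
  · rintro ⟨_, ⟨hF, hS⟩ | ⟨v, hv, rfl⟩, h⟩
    · exact Or.inl ⟨_, hS, hF, h⟩
    · exact Or.inr ⟨v, hv, h⟩
  · rintro (⟨F', hS, hF, h⟩ | ⟨v, hv, h⟩)
    · exact ⟨F', Or.inl ⟨hF, hS⟩, h⟩
    · exact ⟨_, Or.inr ⟨v, hv, rfl⟩, h⟩

variable [Fintype V]

theorem sum_spread {σ : Finset V} (hσ : σ.Nonempty) (w : V) (x : V → ℝ) :
    ∑ v, spread σ w x v = ∑ v, x v := by
  have : (σ.card : ℝ) ≠ 0 := by exact_mod_cast hσ.card_ne_zero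
  simp only [spread, Finset.sum_sub_distrib, Finset.sum_add_distrib, Finset.sum_ite_mem,
    Finset.univ_inter, Finset.sum_const, Finset.sum_ite_eq', Finset.mem_univ, if_true, nsmul_eq_mul]
  field_simp
  ring

theorem sum_collect {σ : Finset V} (hσ : σ.Nonempty) (w : V) (y : V → ℝ) :
    ∑ v, collect hσ w y v = ∑ v, y v := by
  simp only [collect, Finset.sum_sub_distrib, Finset.sum_add_distrib, Finset.sum_ite_mem,
    Finset.univ_inter, Finset.sum_const, Finset.sum_ite_eq', Finset.mem_univ, if_true, nsmul_eq_mul]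
  ring

variable {S : Finset (Finset V)} {F σ : Finset V} {w : V}

theorem spread_mem_realization (hσ : σ.Nonempty) (hF : F ∈ S) (hσF : σ ⊆ F)
    (hw : ∀ F' ∈ S, w ∉ F') {x : V → ℝ}
    (hx : x ∈ realization (generated (stellarFacets S F σ w : Set (Finset V)))) :
    spread σ w x ∈ realization (generated (S : Set (Finset V))) := by
  have hwσ : w ∉ σ := fun h => hw F hF (hσF h)
  obtain ⟨⟨hx0, hx1⟩, τ, hτ, hsupp⟩ := mem_realization_iff.1 hx
  refine mem_realization_iff.2 ⟨⟨fun v => ?_, (sum_spread hσ w x).trans hx1⟩, ?_⟩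
  · unfold spread
    by_cases hvw : v = w
    · subst hvw
      simp [hwσ]
    · have := hx0 v
      have := hx0 w
      rw [if_neg hvw, sub_zero]
      split_ifs <;> positivity
  · rcases mem_generated_stellarFacets.1 hτ with ⟨F', hF', -, hτF'⟩ | ⟨u, hu, hτF⟩
    · have hxw : x w = 0 := by
        by_contra h
        exact hw F' hF' (hτF' (hsupp w h))
      refine ⟨F', subset_lowerClosure hF', fun v hv => hτF' (hsupp v ?_)⟩
      simpa [spread, hxw] using hv
    · refine ⟨F, subset_lowerClosure hF, fun v hv => ?_⟩
      by_cases hvw : v = w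
      · subst hvw
        simp [spread, hwσ] at hv
      by_cases hvσ : v ∈ σ
      · exact hσF hvσ
      · have hv' : x v ≠ 0 := by simpa [spread, hvw, hvσ] using hv
        exact Finset.mem_of_mem_erase (Finset.mem_of_mem_insert_of_ne (hτF (hsupp v hv')) hvw)

/-- In `F`, subtracting the minimum over `σ` kills the coordinate of a minimizing vertex `u`,
leaving the support in `insert w (F.erase u)`. Any other facet misses a vertex of `σ`, so there the
minimum is 0 and nothing changes. -/
theorem collect_mem_realization (hσ : σ.Nonempty) (hσF : ∀ F' ∈ S, σ ⊆ F' → F' = F) {y : V → ℝ}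
    (hy : y ∈ realization (generated (S : Set (Finset V)))) :
    collect hσ w y ∈ realization (generated (stellarFacets S F σ w : Set (Finset V))) := by
  obtain ⟨⟨hy0, hy1⟩, τ, hτ, hsupp⟩ := mem_realization_iff.1 hy
  obtain ⟨F', hF', hτF'⟩ := mem_lowerClosure.1 hτ
  obtain ⟨u, hu, huy⟩ := σ.exists_mem_eq_inf' hσ y
  have ht0 : 0 ≤ σ.inf' hσ y := huy ▸ hy0 u
  refine mem_realization_iff.2 ⟨⟨fun v => ?_, (sum_collect hσ w y).trans hy1⟩, ?_⟩
  · have h1 : 0 ≤ y v - if v ∈ σ then σ.inf' hσ y else 0 := by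
      split_ifs with h
      · exact sub_nonneg.2 (Finset.inf'_le _ h)
      · simpa using hy0 v
    refine add_nonneg h1 ?_
    split_ifs <;> positivity
  · by_cases hFF' : F' = F
    · subst hFF'
      refine ⟨insert w (F'.erase u), mem_generated_stellarFacets.2 (Or.inr ⟨u, hu, subset_rfl⟩),
        fun v hv => ?_⟩
      by_cases hvw : v = w
      · exact hvw ▸ Finset.mem_insert_self _ _
      refine Finset.mem_insert_of_mem (Finset.mem_erase.2 ⟨?_, hτF' (hsupp v ?_)⟩)
      · rintro rfl
        simp [collect, hvw, hu, huy] at hv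
      · intro hyv
        refine hv ?_
        by_cases hvσ : v ∈ σ
        · have : σ.inf' hσ y = 0 := le_antisymm (hyv ▸ Finset.inf'_le y hvσ) ht0
          simp [collect, hvw, hyv, this]
        · simp [collect, hvw, hvσ, hyv]
    · have ht : σ.inf' hσ y = 0 := by
        obtain ⟨v, hv, hvF⟩ := Finset.not_subset.1 (mt (hσF F' hF') hFF')
        have hyv : y v = 0 := by
          by_contra h
          exact hvF (hτF' (hsupp v h))
        exact le_antisymm (hyv ▸ Finset.inf'_le y hv) ht0
      refine ⟨F', mem_generated_stellarFacets.2 (Or.inl ⟨F', hF', hFF', subset_rfl⟩),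
        fun v hv => hτF' (hsupp v ?_)⟩
      simpa [collect, ht] using hv

/-- No face of the subdivision contains `σ`, so some coordinate of `x` on `σ` is 0. The minimum of
the spread point over `σ` is therefore `x w / σ.card`, which recovers `x w`. -/
theorem collect_spread (hσ : σ.Nonempty) (hwσ : w ∉ σ) (hσF : ∀ F' ∈ S, σ ⊆ F' → F' = F)
    {x : V → ℝ} (hx : x ∈ realization (generated (stellarFacets S F σ w : Set (Finset V)))) :
    collect hσ w (spread σ w x) = x := by
  obtain ⟨⟨hx0, -⟩, τ, hτ, hsupp⟩ := mem_realization_iff.1 hx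
  have hne : ∀ v ∈ σ, v ≠ w := fun v hv h => hwσ (h ▸ hv)
  have hcard : (σ.card : ℝ) ≠ 0 := by exact_mod_cast hσ.card_ne_zero
  obtain ⟨u, hu, hxu⟩ : ∃ u ∈ σ, x u = 0 := by
    by_contra! h
    have hστ : σ ⊆ τ := fun v hv => hsupp v (h v hv)
    rcases mem_generated_stellarFacets.1 hτ with ⟨F', hF', hne', hτF'⟩ | ⟨u, hu, hτF⟩
    · exact hne' (hσF F' hF' (hστ.trans hτF'))
    · have := hτF (hστ hu)
      simp [hne u hu] at this
  have ht : σ.inf' hσ (spread σ w x) = x w / σ.card := by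
    apply le_antisymm
    · refine (Finset.inf'_le _ hu).trans ?_
      simp [spread, hu, hne u hu, hxu]
    · refine Finset.le_inf' _ _ fun v hv => ?_
      simpa [spread, hv, hne v hv] using hx0 v
  ext v
  simp only [collect, ht, spread]
  by_cases hvw : v = w
  · subst hvw
    simp [hwσ]
    field_simp
  · simp [hvw]

/-- A stellar subdivision does not change the geometric realization. -/
theorem nonempty_stellarHomeomorph (hσ : σ.Nonempty) (hF : S.filter (σ ⊆ ·) = {F})
    (hw : w ∉ S.biUnion id) :
    Nonempty (realization (generated (stellarFacets S F σ w : Set (Finset V))) ≃ₜ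
      realization (generated (S : Set (Finset V)))) := by
  have hmem : ∀ F', F' ∈ S ∧ σ ⊆ F' ↔ F' = F := fun F' => by
    rw [← Finset.mem_filter, hF, Finset.mem_singleton]
  obtain ⟨hFS, hσF⟩ := (hmem F).2 rfl
  have hunique : ∀ F' ∈ S, σ ⊆ F' → F' = F := fun F' h h' => (hmem F').1 ⟨h, h'⟩
  have hw' : ∀ F' ∈ S, w ∉ F' := fun F' h h' => hw (Finset.mem_biUnion.2 ⟨F', h, h'⟩)
  have hwσ : w ∉ σ := fun h => hw' F hFS (hσF h)
  refine ⟨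
    { toFun := fun x => ⟨spread σ w x, spread_mem_realization hσ hFS hσF hw' x.2⟩
      invFun := fun y => ⟨collect hσ w y, collect_mem_realization hσ hunique y.2⟩
      left_inv := fun x => Subtype.ext (collect_spread hσ hwσ hunique x.2)
      right_inv := fun y => Subtype.ext (spread_collect hσ hwσ ?_)
      continuous_toFun := ((continuous_spread σ w).comp continuous_subtype_val).subtype_mk _
      continuous_invFun := ((continuous_collect hσ w).comp continuous_subtype_val).subtype_mk _ }⟩
  obtain ⟨-, τ, hτ, hsupp⟩ := mem_realization_iff.1 y.2
  obtain ⟨F', hF', hτF'⟩ := mem_lowerClosure.1 hτ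
  by_contra h
  exact hw' F' hF' (hτF' (hsupp w h))

end Stellar

/-! ### The tetrahedron -/

/-- The standard tetrahedron in `ℝ³`. -/
def tetrahedron : Set (EuclideanSpace ℝ (Fin 3)) := {p | (∀ i, 0 ≤ p i) ∧ ∑ i, p i ≤ 1}

theorem convex_tetrahedron : Convex ℝ tetrahedron := by
  rintro p ⟨hp, hp'⟩ q ⟨hq, hq'⟩ a b ha hb hab
  refine ⟨fun i => ?_, ?_⟩
  · have := hp i
    have := hq i
    simp only [PiLp.add_apply, PiLp.smul_apply, smul_eq_mul]
    positivity
  · simp only [PiLp.add_apply, PiLp.smul_apply, smul_eq_mul, Finset.sum_add_distrib,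
      ← Finset.mul_sum]
    nlinarith

theorem isClosed_tetrahedron : IsClosed tetrahedron := by
  refine IsClosed.inter (s₁ := {p : EuclideanSpace ℝ (Fin 3) | ∀ i, 0 ≤ p i})
    (s₂ := {p | ∑ i, p i ≤ 1}) ?_ ?_
  · rw [Set.ofPred_forall]
    exact isClosed_iInter fun i => isClosed_le continuous_const (by fun_prop)
  · exact isClosed_le (by fun_prop) continuous_const

theorem nonempty_interior_tetrahedron : (interior tetrahedron).Nonempty := by
  let U : Set (EuclideanSpace ℝ (Fin 3)) := {p | (∀ i, 0 < p i) ∧ ∑ i, p i < 1}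
  have hU : IsOpen U := by
    refine IsOpen.inter (s := {p : EuclideanSpace ℝ (Fin 3) | ∀ i, 0 < p i})
      (t := {p | ∑ i, p i < 1}) ?_ ?_
    · rw [Set.ofPred_forall]
      exact isOpen_iInter_of_finite fun i => isOpen_lt continuous_const (by fun_prop)
    · exact isOpen_lt (by fun_prop) continuous_const
  have hUT : U ⊆ tetrahedron := fun p hp => ⟨fun i => (hp.1 i).le, le_of_lt hp.2⟩
  refine ⟨WithLp.toLp 2 fun _ => 1 / 4, interior_maximal hUT hU ⟨fun i => ?_, ?_⟩⟩
  · norm_num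
  · simp
    norm_num

theorem isBounded_tetrahedron : Bornology.IsBounded tetrahedron := by
  refine (Metric.isBounded_closedBall (x := 0) (r := 1)).subset fun p hp => ?_
  rw [mem_closedBall_zero_iff, EuclideanSpace.norm_eq, Real.sqrt_le_one]
  refine le_trans (Finset.sum_le_sum fun i _ => ?_) hp.2
  have h1 : p i ≤ 1 := (Finset.single_le_sum (fun j _ => hp.1 j) (Finset.mem_univ i)).trans hp.2
  have h0 := hp.1 i
  rw [Real.norm_of_nonneg h0]
  nlinarith

theorem nonempty_tetrahedron_homeomorph_closedBall :
    Nonempty (tetrahedron ≃ₜ Metric.closedBall (0 : EuclideanSpace ℝ (Fin 3)) 1) := by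
  obtain ⟨h, -, hclosure, -⟩ := exists_homeomorph_image_interior_closure_frontier_eq_unitBall
    convex_tetrahedron nonempty_interior_tetrahedron isBounded_tetrahedron
  rw [isClosed_tetrahedron.closure_eq] at hclosure
  exact ⟨(h.image tetrahedron).trans (Homeomorph.setCongr hclosure)⟩

theorem mem_realization_simplex_iff {x : Fin 12 → ℝ} :
    x ∈ realization (generated (({{B, D, F, H}} : Finset (Finset (Fin 12))) :
      Set (Finset (Fin 12)))) ↔
      x ∈ stdSimplex ℝ (Fin 12) ∧ ∀ v ∉ ({B, D, F, H} : Finset _), x v = 0 := by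
  rw [mem_realization_iff]
  refine and_congr_right fun _ => ⟨?_, ?_⟩
  · rintro ⟨τ, hτ, h⟩ v hv
    obtain ⟨F', hF', hτF'⟩ := mem_lowerClosure.1 hτ
    rw [SetLike.mem_coe, Finset.mem_singleton] at hF'
    subst hF'
    by_contra hxv
    exact hv (hτF' (h v hxv))
  · intro h
    refine ⟨{B, D, F, H}, subset_lowerClosure (by simp), fun v hv => ?_⟩
    by_contra hv'
    exact hv (h v hv')

/-- The point of the simplex `BDFH` whose last three barycentric coordinates are given by `p`. -/
def simplexPoint (p : EuclideanSpace ℝ (Fin 3)) : Fin 12 → ℝ :=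
  ![0, 1 - ∑ i, p i, 0, p 0, 0, p 1, 0, p 2, 0, 0, 0, 0]

theorem simplexPoint_mem {p : EuclideanSpace ℝ (Fin 3)} (hp : p ∈ tetrahedron) :
    simplexPoint p ∈ realization (generated (({{B, D, F, H}} : Finset (Finset (Fin 12))) :
      Set (Finset (Fin 12)))) := by
  obtain ⟨h0, h1⟩ := hp
  refine mem_realization_simplex_iff.2 ⟨⟨fun v => ?_, ?_⟩, fun v hv => ?_⟩
  · have := h0 0
    have := h0 1
    have := h0 2
    fin_cases v <;> simp [simplexPoint] <;> assumption
  · simp [simplexPoint, Fin.sum_univ_succ]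
  · fin_cases v <;> simp [simplexPoint] at hv ⊢

/-- The simplex `BDFH` is a tetrahedron. -/
noncomputable def simplexHomeomorph :
    realization (generated (({{B, D, F, H}} : Finset (Finset (Fin 12))) :
      Set (Finset (Fin 12)))) ≃ₜ tetrahedron where
  toFun x := ⟨!₂[x.1 D, x.1 F, x.1 H], by
    obtain ⟨⟨h0, h1⟩, h⟩ := mem_realization_simplex_iff.1 x.2
    refine ⟨fun i => ?_, ?_⟩
    · fin_cases i <;> exact h0 _
    · rw [← h1, Fin.sum_univ_three]
      refine le_of_eq_of_le ?_ (Finset.sum_le_univ_sum_of_nonneg (s := {D, F, H}) h0)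
      rw [Finset.sum_insert (by decide), Finset.sum_insert (by decide), Finset.sum_singleton,
        ← add_assoc]
      rfl⟩
  invFun p := ⟨simplexPoint p, simplexPoint_mem p.2⟩
  left_inv x := by
    obtain ⟨⟨h0, h1⟩, h⟩ := mem_realization_simplex_iff.1 x.2
    have hB : x.1 B = 1 - (x.1 D + x.1 F + x.1 H) := by
      rw [← h1, ← Finset.sum_subset (Finset.subset_univ {B, D, F, H}) fun v _ hv => h v hv,
        Finset.sum_insert (by decide), Finset.sum_insert (by decide), Finset.sum_insert (by decide),
        Finset.sum_singleton]
      ring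
    apply Subtype.ext
    ext v
    fin_cases v <;> simp [simplexPoint, Fin.sum_univ_three]
    · exact (h 0 (by decide)).symm
    · exact hB.symm
    · exact (h 2 (by decide)).symm
    · exact (h 4 (by decide)).symm
    · exact (h 6 (by decide)).symm
    · exact (h 8 (by decide)).symm
    · exact (h 9 (by decide)).symm
    · exact (h 10 (by decide)).symm
    · exact (h 11 (by decide)).symm
  right_inv p := by
    apply Subtype.ext
    ext i
    fin_cases i <;> rfl
  continuous_toFun := by
    refine Continuous.subtype_mk ?_ _
    refine (PiLp.continuous_toLp 2 _).comp (continuous_pi fun i => ?_)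
    fin_cases i
    · exact (continuous_apply D).comp continuous_subtype_val
    · exact (continuous_apply F).comp continuous_subtype_val
    · exact (continuous_apply H).comp continuous_subtype_val
  continuous_invFun := by
    refine Continuous.subtype_mk (continuous_pi fun v => ?_) _
    fin_cases v <;> simp [simplexPoint] <;> fun_prop

/-! ### The complex `Γ` is a ball -/

/-- Starting from `BDFH`, the boundary triangles `DFH`, `CFH`, `CFG`, `CEG` are subdivided by `C`,
`G`, `E`, `A`. Each step replaces one tetrahedron by three, and the ninefold result is `Γ`. -/
theorem isSimplicialBall_Γ : IsSimplicialBall 3 Γ := by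
  let S₀ : Finset (Finset (Fin 12)) := {{B, D, F, H}}
  let S₁ := stellarFacets S₀ {B, D, F, H} {D, F, H} C
  let S₂ := stellarFacets S₁ {B, C, F, H} {C, F, H} G
  let S₃ := stellarFacets S₂ {B, C, F, G} {C, F, G} E
  obtain ⟨e₁⟩ := nonempty_stellarHomeomorph (S := S₀) (F := {B, D, F, H}) (σ := {D, F, H}) (w := C)
    (by decide) (by decide) (by decide)
  obtain ⟨e₂⟩ := nonempty_stellarHomeomorph (S := S₁) (F := {B, C, F, H}) (σ := {C, F, H}) (w := G)
    (by decide) (by decide) (by decide)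
  obtain ⟨e₃⟩ := nonempty_stellarHomeomorph (S := S₂) (F := {B, C, F, G}) (σ := {C, F, G}) (w := E)
    (by decide) (by decide) (by decide)
  obtain ⟨e₄⟩ := nonempty_stellarHomeomorph (S := S₃) (F := {B, C, E, G}) (σ := {C, E, G}) (w := A)
    (by decide) (by decide) (by decide)
  have hΓ : stellarFacets S₃ {B, C, E, G} {C, E, G} A = facetsΓ := by decide
  obtain ⟨e⟩ := nonempty_tetrahedron_homeomorph_closedBall
  rw [hΓ] at e₄
  exact ⟨e₄.trans (e₃.trans (e₂.trans (e₁.trans (simplexHomeomorph.trans e))))⟩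

end BoolDecomp

theorem mainTheorem1 (𝕜 : Type*) [Field 𝕜] :
    BoolDecomp.IsSimplicialBall 3 BoolDecomp.Γ ∧
    BoolDecomp.IsInducedSubcomplex BoolDecomp.Γ BoolDecomp.Δ ∧
    BoolDecomp.HasDim (BoolDecomp.Ω 17) 3 ∧
    BoolDecomp.FoldAcyclic 𝕜 2 (BoolDecomp.Ω 17) ∧
    (¬ ∃ B : Set (Set (BoolDecomp.Ω 17)), BoolDecomp.IsBooleanDecomposition 2 B) ∧
    ¬ BoolDecomp.StanleyConjecture 𝕜 := by
  refine ⟨BoolDecomp.isSimplicialBall_Γ, BoolDecomp.isInducedSubcomplex_Γ_Δ,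
    BoolDecomp.hasDim_Ω (by norm_num), BoolDecomp.foldAcyclic_Ω 𝕜 17, ?_, fun h => ?_⟩
  · rintro ⟨𝓑, h𝓑⟩
    exact BoolDecomp.not_isBooleanDecomposition_Ω (by norm_num) 𝓑 h𝓑
  · have : Fintype (Fin 12 ⊕ₗ (Fin 17 ×ₗ Fin 12)) :=
      inferInstanceAs (Fintype (Fin 12 ⊕ (Fin 17 × Fin 12)))
    obtain ⟨𝓑, h𝓑, -⟩ := h (Fin 12 ⊕ₗ (Fin 17 ×ₗ Fin 12)) 2 (BoolDecomp.Ω 17)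
      (BoolDecomp.foldAcyclic_Ω 𝕜 17)
    exact BoolDecomp.not_isBooleanDecomposition_Ω (by norm_num) 𝓑 h𝓑
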